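/- Let $n>1$. Consider compressible fluid flow on $\mathbb R^n$ with velocity $\mathbf u$, density $\rho>0$ and entropy $S$, $$\partial_t\mathbf u+\mathbf u\cdot\nabla\mathbf u+\tfrac1\rho\nabla p=0,\qquad \partial_t\rho+\nabla\cdot(\rho\mathbf u)=0,\qquad \partial_t S+\mathbf u\cdot\nabla S=0,\qquad p=P(\rho,S),$$ with $P$ smooth on $\rho>0$. The equation of state is called non-isentropic if $\partial P/\partial S\not\equiv0$ on $(0,\infty)\times I$ for every nonempty open interval $I$ of entropy values. In the isentropic case the entropy is constant, the system is the one for $(\mathbf u,\rho)$ with $p=P(\rho)$, $P$ smooth and not constant, and $S$ is dropped from all functions below. Let $\omega^{ij}=\frac12(\partial_ju^i-\partial_iu^j)$. The vorticity is the scalar $\varpi=\epsilon^{i_1j_1\cdots i_mj_m}\omega_{i_1j_1}\cdots\omega_{i_mj_m}$ if $n=2m$, and the vector $\boldsymbol\varpi$ with components $\varpi^i=\epsilon^{ij_1k_1\cdots j_mk_m}\omega_{j_1k_1}\cdots\omega_{j_mk_m}$ if $n=2m+1$, where $\epsilon$ is the totally antisymmetric tensor. A smooth density of vorticity form is a smooth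 function $T(\rho,S,\mathbf u,\varpi)$, respectively $T(\rho,S,\mathbf u,\boldsymbol\varpi)$. It is conserved on domains $V(t)$ moving with the fluid, $\frac{d}{dt}\int_{V(t)}T\,d^nx=0$ formally for all solutions, when $$\mathcal D_tT+D_{\mathbf x}\cdot(\mathbf uT)=0$$ holds identically for all smooth fields with $\rho>0$, where $D_{\mathbf x}$ is the total spatial derivative and $\mathcal D_t$ is the total time derivative with all time derivatives of the fields eliminated by the equations of motion. Such a $T$ is a vorticity constant of motion if, in addition, it is nontrivial and depends essentially on the vorticity: $T$ is not of the form $K+D_{\mathbf x}\cdot\boldsymbol\Theta$ with $K$ a smooth function of $t,\mathbf x,\mathbf u,\rho,S$ and $\boldsymbol\Theta$ a smooth function of $t,\mathbf x,\mathbf u,\rho,S$ and finitely many $\mathbf x$-derivatives of $\mathbf u,\rho,S$. (i) For any non-isentropic equation of state, in any dimension $n>1$, there are no vorticity constants of motion; in fact every smooth density of vorticity form that is conserved on moving domains is independent of the vorticity. (ii) For any isentropic equation of state: in even dimensions $n=2m$ the vorticity constants of motion are exactly the enstrophies $\int_{V(t)}\rho f(\varpi/\rho)\,d^nx$ with $f$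 a smooth nonlinear (that is, not affine) function, and the smooth densities of vorticity form conserved on moving domains are exactly $T=\rho f(\varpi/\rho)$ with $f$ any smooth function; in odd dimensions there are no vorticity constants of motion, and every smooth density of vorticity form that is conserved on moving domains is independent of the vorticity. -/

import Mathlib

open scoped ContDiff

noncomputable section

namespace CompressibleFlow

/-- Euclidean space `ℝⁿ`. -/
abbrev Space (n : ℕ) := EuclideanSpace ℝ (Fin n)

/-- The `j`-th partial derivative `∂_j F` of a map on `ℝⁿ`. -/
def partialDeriv {n : ℕ} {F : Type*} [NormedAddCommGroup F] [NormedSpace ℝ F]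
    (j : Fin n) (f : Space n → F) (x : Space n) : F :=
  fderiv ℝ f x (EuclideanSpace.single j 1)

/-- The divergence `∑ i, ∂_i X^i` of a vector field on `ℝⁿ`. -/
def divergence {n : ℕ} (X : Space n → Space n) (x : Space n) : ℝ :=
  ∑ i, partialDeriv i X x i

/-! ### Vorticity -/

/-- The curl of the velocity, `ω^{ij} = ½ (∂_j u^i - ∂_i u^j)`. -/
def curl {n : ℕ} (u : Space n → Space n) (x : Space n) (i j : Fin n) : ℝ :=
  (1 / 2) * (partialDeriv j u x i - partialDeriv i u x j)

/-- The vorticity scalar in even dimension `n = 2m`,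
`ϖ = ε^{i₁ j₁ ⋯ i_m j_m} ω_{i₁ j₁} ⋯ ω_{i_m j_m}`; the contraction with the totally
antisymmetric tensor `ε` is written as a sum over permutations of the indices. -/
def vorticityScalar (m : ℕ) (u : Space (2 * m) → Space (2 * m)) (x : Space (2 * m)) : ℝ :=
  ∑ σ : Equiv.Perm (Fin (2 * m)), ((Equiv.Perm.sign σ : ℤ) : ℝ) *
    ∏ k : Fin m, curl u x (σ ⟨2 * k, by omega⟩) (σ ⟨2 * k + 1, by omega⟩)

/-- The vorticity vector in odd dimension `n = 2m + 1`,
`ϖ^i = ε^{i j₁ k₁ ⋯ j_m k_m} ω_{j₁ k₁} ⋯ ω_{j_m k_m}`. -/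
def vorticityVector (m : ℕ) (u : Space (2 * m + 1) → Space (2 * m + 1))
    (x : Space (2 * m + 1)) : Space (2 * m + 1) :=
  WithLp.toLp 2 fun i =>
    ∑ σ : Equiv.Perm (Fin (2 * m + 1)), if σ 0 = i then ((Equiv.Perm.sign σ : ℤ) : ℝ) *
      ∏ k : Fin m, curl u x (σ ⟨2 * k + 1, by omega⟩) (σ ⟨2 * k + 2, by omega⟩) else 0

/-! ### The Euler equations, solved for the time derivatives

A state of the fluid at an instant is a field `x ↦ (u, ρ, S)` (non-isentropic flow, entropy is
a dynamical variable) or `x ↦ (u, ρ)` (isentropic flow, entropy is constant). -/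

/-- `∂_t u = - u·∇u - ρ⁻¹ ∇p`. -/
def velocityRate {n : ℕ} (u : Space n → Space n) (ρ p : Space n → ℝ) (x : Space n) : Space n :=
  -(fderiv ℝ u x (u x)) - (ρ x)⁻¹ • gradient p x

/-- `∂_t ρ = - ∇·(ρ u)`. -/
def densityRate {n : ℕ} (u : Space n → Space n) (ρ : Space n → ℝ) (x : Space n) : ℝ :=
  -divergence (fun y => ρ y • u y) x

/-- `∂_t S = - u·∇S`. -/
def entropyRate {n : ℕ} (u : Space n → Space n) (S : Space n → ℝ) (x : Space n) : ℝ :=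
  -(fderiv ℝ S x (u x))

/-- Time derivative of `(u, ρ, S)` for the equation of state `p = P(ρ, S)`. -/
def eulerRate {n : ℕ} (P : ℝ → ℝ → ℝ) (q : Space n → Space n × ℝ × ℝ) (x : Space n) :
    Space n × ℝ × ℝ :=
  let u := fun y => (q y).1
  let ρ := fun y => (q y).2.1
  let S := fun y => (q y).2.2
  (velocityRate u ρ (fun y => P (ρ y) (S y)) x, densityRate u ρ x, entropyRate u S x)

/-- Time derivative of `(u, ρ)` for the isentropic equation of state `p = P(ρ)`. -/
def isentropicRate {n : ℕ} (P : ℝ → ℝ) (q : Space n → Space n × ℝ) (x : Space n) :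
    Space n × ℝ :=
  let u := fun y => (q y).1
  let ρ := fun y => (q y).2
  (velocityRate u ρ (fun y => P (ρ y)) x, densityRate u ρ x)

/-- Physical values `(u, ρ, S)`: positive density. -/
def physical (n : ℕ) : Set (Space n × ℝ × ℝ) := {s | 0 < s.2.1}

/-- Physical values `(u, ρ)`: positive density. -/
def isentropicPhysical (n : ℕ) : Set (Space n × ℝ) := {s | 0 < s.2}

/-! ### Constants of motion

Below `G` is the space of the thermodynamic variables, `(ρ, S)` or `ρ`; `Ω` is the set of physical
values of the state; `rate` is the time derivative of a state prescribed by the Euler equations;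
`vort u x` is the vorticity of the velocity field `u`, with values in `V`; and `T s w` is a density
of vorticity form, a function of the state `s` and the vorticity `w`. -/

section

variable {n : ℕ} {F G V : Type*} [NormedAddCommGroup F] [NormedSpace ℝ F]
  [NormedAddCommGroup G] [NormedSpace ℝ G] [NormedAddCommGroup V] [NormedSpace ℝ V]

/-- Smooth fields with values in `Ω`. -/
def IsSmoothField (Ω : Set F) (q : Space n → F) : Prop :=
  ContDiff ℝ ∞ q ∧ ∀ x, q x ∈ Ω

/-- The value at `x` of the density `T` on the state `q`. -/
def densityAt (vort : (Space n → Space n) → Space n → V) (T : Space n × G → V → ℝ)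
    (q : Space n → Space n × G) (x : Space n) : ℝ :=
  T (q x) (vort (fun y => (q y).1) x)

/-- The total time derivative `𝒟_t T` evaluated on formal solutions: all time derivatives of the
fields (and, through the vorticity, of their spatial derivatives) are eliminated by means of the
equations of motion. -/
def timeDeriv (rate : (Space n → Space n × G) → Space n → Space n × G)
    (vort : (Space n → Space n) → Space n → V) (T : Space n × G → V → ℝ)
    (q : Space n → Space n × G) (x : Space n) : ℝ :=
  deriv (fun τ : ℝ => densityAt vort T (fun y => q y + τ • rate q y) x) 0

/-- `T` is a smooth density whose integral over every domain moving with the fluid is constant,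
in the local form `𝒟_t T + D_x·(u T) = 0` (zero net flux through the moving boundary), formally for
all solutions of the equations of motion. -/
def IsConservedOnMovingDomains (Ω : Set (Space n × G))
    (rate : (Space n → Space n × G) → Space n → Space n × G)
    (vort : (Space n → Space n) → Space n → V) (T : Space n × G → V → ℝ) : Prop :=
  ContDiffOn ℝ ∞ (fun z : (Space n × G) × V => T z.1 z.2) {z | z.1 ∈ Ω} ∧
  ∀ q, IsSmoothField Ω q → ∀ x,
    timeDeriv rate vort T q x + divergence (fun y => densityAt vort T q y • (q y).1) x = 0

/-- The differential expression `L t q x` is a spatial divergence `D_x·Θ`, where `Θ` is a smooth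
local function of `t`, `x`, the fields, and their `x`-derivatives up to some finite order `k`;
identically in all (not necessarily evolving) fields. -/
def IsSpatialDivergence (Ω : Set F) (L : ℝ → (Space n → F) → Space n → ℝ) : Prop :=
  ∃ (k : ℕ) (Θ : ℝ × Space n × F ×
      ((j : Fin k) → ContinuousMultilinearMap ℝ (fun _ : Fin (j + 1) => Space n) F) → Space n),
    ContDiffOn ℝ ∞ Θ {z | z.2.2.1 ∈ Ω} ∧
    ∀ t q, IsSmoothField Ω q → ∀ x,
      L t q x = divergence
        (fun y => Θ (t, y, q y, fun j : Fin k => iteratedFDeriv ℝ (j + 1) q y)) x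

/-- Up to a trivial density (a spatial divergence), `T` is a kinematic density, a smooth function
`K` of `t`, `x` and the undifferentiated fields. For `K = 0` this says that `T` is trivial. -/
def IsKinematicUpToDivergence (Ω : Set (Space n × G))
    (vort : (Space n → Space n) → Space n → V) (T : Space n × G → V → ℝ) : Prop :=
  ∃ K : ℝ × Space n × (Space n × G) → ℝ,
    ContDiffOn ℝ ∞ K {z | z.2.2 ∈ Ω} ∧
    IsSpatialDivergence Ω fun t q x => densityAt vort T q x - K (t, x, q x)

/-- A vorticity constant of motion: a density conserved on all moving domains that is nontrivial
and depends essentially on the vorticity. -/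
def IsVorticityConstantOfMotion (Ω : Set (Space n × G))
    (rate : (Space n → Space n × G) → Space n → Space n × G)
    (vort : (Space n → Space n) → Space n → V) (T : Space n × G → V → ℝ) : Prop :=
  IsConservedOnMovingDomains Ω rate vort T ∧ ¬ IsKinematicUpToDivergence Ω vort T

/-- On physical states the density does not depend on the vorticity. -/
def IsVorticityIndependent (Ω : Set (Space n × G)) (T : Space n × G → V → ℝ) : Prop :=
  ∀ s ∈ Ω, ∀ w w' : V, T s w = T s w'

end

/-! ### Equations of state -/

/-- A smooth non-isentropic equation of state `p = P(ρ, S)`, `ρ > 0`: there is no open interval of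
entropy values on which the pressure is independent of the entropy. -/
def IsNonIsentropicEOS (P : ℝ → ℝ → ℝ) : Prop :=
  ContDiffOn ℝ ∞ (fun z : ℝ × ℝ => P z.1 z.2) {z | 0 < z.1} ∧
  ∀ a b : ℝ, a < b → ∃ S ∈ Set.Ioo a b, ∃ ρ > 0, deriv (fun s => P ρ s) S ≠ 0

/-- A smooth isentropic equation of state `p = P(ρ)`, `ρ > 0`, not constant. -/
def IsIsentropicEOS (P : ℝ → ℝ) : Prop :=
  ContDiffOn ℝ ∞ P (Set.Ioi 0) ∧ ∃ ρ > 0, deriv P ρ ≠ 0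

/-- `T = ρ f(ϖ/ρ)`, the enstrophy density of the function `f`. -/
def IsEnstrophyDensity {n : ℕ} (f : ℝ → ℝ) (T : Space n × ℝ → ℝ → ℝ) : Prop :=
  ∀ (u : Space n) (ρ ϖ : ℝ), 0 < ρ → T (u, ρ) ϖ = ρ * f (ϖ / ρ)

/-- `f` is an affine function (a linear function up to a constant). -/
def IsAffine (f : ℝ → ℝ) : Prop := ∃ a b : ℝ, ∀ s, f s = a * s + b

end CompressibleFlow

end

open CompressibleFlow

/-! Write A for the velocity gradient, ω for its antisymmetric part and D for the derivative along
the flow. The momentum equation gives Dω = -(Aᵀω + ωA) + b, where the baroclinic term b is built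
from ∇ρ ∧ ∇p (`curl_velocityRate_add`). The vorticity ϖ is algebraic in ω. In even dimension it is a
multiple of the Pfaffian, with ϖ(MωMᵀ) = det M · ϖ(ω); in odd dimension it satisfies Mᵀϖ(MωMᵀ) = det
M · ϖ(ω) (`scalarForm_conj`, `vectorForm_conj`). Differentiating these laws at M = 1 gives, apart
from b, Dϖ = -(div u)ϖ in even dimension and Dϖ = -(div u)ϖ + Aϖ in odd dimension.

The conservation condition at a point therefore involves only the values and first derivatives of
the fields there, and these can be prescribed freely (`isentropic_identity`, `euler_identity`). The
classification is then pointwise algebra.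

Odd dimension: for uniform ρ and S and traceless A the condition says ∂T/∂ϖ · Aϖ = 0. Adding a
symmetric traceless matrix to A leaves ϖ unchanged but moves Aϖ by an arbitrary vector, so ∂T/∂ϖ =
0.

Even dimension: the trace of A yields Euler's relation, so T is homogeneous of degree one in (ρ, ϖ).
In the isentropic case b = 0, and the pressure gradient excludes dependence on u, which leaves T = ρ
f(ϖ/ρ). In the non-isentropic case b changes ϖ wherever ∂P/∂S ≠ 0, which excludes dependence on ϖ
there; homogeneity and continuity do the rest.

Nontriviality: an affine f gives aϖ + bρ (a, b now constants), and ϖ is a divergence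
(`divergence_pairPotential`). Conversely, on fields with ρ = 1 and u = linear + h e₀ chosen so that
ϖ = κ ∂₁h, a density that is kinematic up to a divergence makes f(κ ∂₁h) - g(x, h) a null
Lagrangian, and its Euler-Lagrange equation forces f'' = 0 (`IsEnstrophyDensity.isAffine`). -/

namespace CompressibleFlow

/-! ### Signed permutation sums and their behaviour under congruence of the matrix. -/

section PairSum

variable {ι κ : Type*} [Fintype ι] [DecidableEq ι] [Fintype κ] [DecidableEq κ]

/-- The signed sum over permutations `σ` of `W σ ∏ k, M k (σ (l k)) (σ (r k))`: the index slots
`l k` and `r k` are contracted with the matrix `M k`, the remaining ones with `W`. -/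
noncomputable def pairSum (l r : κ ↪ ι) (W : (ι → ι) → ℝ) (M : κ → ι → ι → ℝ) : ℝ :=
  ∑ σ : Equiv.Perm ι, ((Equiv.Perm.sign σ : ℤ) : ℝ) * (W σ * ∏ k, M k (σ (l k)) (σ (r k)))

/-- The antisymmetric part of a matrix. -/
noncomputable def skewPart (A : ι → ι → ℝ) (i j : ι) : ℝ := (1 / 2) * (A i j - A j i)

variable {l r : κ ↪ ι}

omit [Fintype ι] [DecidableEq ι] in
theorem prod_update_pair (M : κ → ι → ι → ℝ) (a : κ) (N : ι → ι → ℝ) (f g : κ → ι) :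
    ∏ k, Function.update M a N k (f k) (g k) =
      N (f a) (g a) * ∏ k ∈ Finset.univ.erase a, M k (f k) (g k) := by
  rw [← Finset.mul_prod_erase _ _ (Finset.mem_univ a), Function.update_self]
  congr 1
  refine Finset.prod_congr rfl fun k hk => ?_
  rw [Function.update_of_ne (Finset.ne_of_mem_erase hk)]

/-- Reindexing by the transposition of `l a` and `r a` flips the sign and exchanges the two indices
of the factor `a`, while the other factors and `W` are unaffected. -/
theorem pairSum_update_transpose (hlr : ∀ a b, l a ≠ r b) {W : (ι → ι) → ℝ}
    (hW : ∀ (σ : Equiv.Perm ι) a, W (σ * Equiv.swap (l a) (r a) : Equiv.Perm ι) = W σ)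
    (M : κ → ι → ι → ℝ) (a : κ) (N : ι → ι → ℝ) :
    pairSum l r W (Function.update M a fun i j => N j i) =
      -pairSum l r W (Function.update M a N) := by
  unfold pairSum
  rw [← Finset.sum_neg_distrib]
  refine Fintype.sum_equiv (Equiv.mulRight (Equiv.swap (l a) (r a))) _ _ fun σ => ?_
  simp only [prod_update_pair, Equiv.coe_mulRight, hW, Equiv.Perm.sign_mul,
    Equiv.Perm.sign_swap (hlr a a), Equiv.Perm.mul_apply, Equiv.swap_apply_left,
    Equiv.swap_apply_right]
  have : ∏ k ∈ Finset.univ.erase a,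
        M k (σ (Equiv.swap (l a) (r a) (l k))) (σ (Equiv.swap (l a) (r a) (r k))) =
      ∏ k ∈ Finset.univ.erase a, M k (σ (l k)) (σ (r k)) := by
    refine Finset.prod_congr rfl fun k hk => ?_
    have hk := Finset.ne_of_mem_erase hk
    rw [Equiv.swap_apply_of_ne_of_ne (l.injective.ne hk) (hlr k a),
      Equiv.swap_apply_of_ne_of_ne (hlr a k).symm (r.injective.ne hk)]
  rw [this]
  push_cast
  ring

theorem pairSum_update_skewPart (hlr : ∀ a b, l a ≠ r b) {W : (ι → ι) → ℝ}
    (hW : ∀ (σ : Equiv.Perm ι) a, W (σ * Equiv.swap (l a) (r a) : Equiv.Perm ι) = W σ)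
    (M : κ → ι → ι → ℝ) (a : κ) :
    pairSum l r W (Function.update M a (skewPart (M a))) = pairSum l r W M := by
  have h : pairSum l r W (Function.update M a (skewPart (M a))) =
      (1 / 2) * (pairSum l r W (Function.update M a (M a)) -
        pairSum l r W (Function.update M a fun i j => M a j i)) := by
    unfold pairSum
    rw [← Finset.sum_sub_distrib, Finset.mul_sum]
    refine Finset.sum_congr rfl fun σ _ => ?_
    simp only [prod_update_pair, skewPart]
    ring
  rw [h, pairSum_update_transpose hlr hW M a (M a), Function.update_eq_self]
  ring

/-- The symmetric part of each factor drops out, one slot at a time. This allows the vorticity to be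
computed from the full velocity gradient, or from any convenient matrix with the right antisymmetric
part. -/
theorem pairSum_skewPart (hlr : ∀ a b, l a ≠ r b) {W : (ι → ι) → ℝ}
    (hW : ∀ (σ : Equiv.Perm ι) a, W (σ * Equiv.swap (l a) (r a) : Equiv.Perm ι) = W σ)
    (M : κ → ι → ι → ℝ) :
    pairSum l r W (fun k => skewPart (M k)) = pairSum l r W M := by
  suffices h : ∀ s : Finset κ,
      pairSum l r W (fun k => if k ∈ s then skewPart (M k) else M k) = pairSum l r W M by
    simpa using h Finset.univ
  intro s
  induction s using Finset.induction_on with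
  | empty => simp
  | insert a s ha ih =>
    rw [← ih, ← pairSum_update_skewPart hlr hW (fun k => if k ∈ s then skewPart (M k) else M k) a]
    congr 1
    funext k
    by_cases hk : k = a
    · subst hk; simp [ha]
    · simp [hk]

/-- The multilinear form whose alternatization is the pair sum. -/
noncomputable def pairForm (hlr : ∀ a b, l a ≠ r b)
    (W : MultilinearMap ℝ (fun _ : {i : ι // i ∉ Set.range l ∪ Set.range r} => ι → ℝ) ℝ)
    (w : ι → ι → ℝ) : MultilinearMap ℝ (fun _ : ι => ι → ℝ) ℝ :=
  -- Multilinearity, one position at a time: the vector at `i` enters a single factor on the left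
  -- (`i = l a`), a single factor on the right (`i = r a`), or only `W`; in each case an explicit
  -- linear functional describes the dependence.
  have key : ∀ (v : ι → ι → ℝ) (i : ι), ∃ L : (ι → ℝ) →ₗ[ℝ] ℝ, ∀ x,
      W (fun z => Function.update v i x z) *
        ∏ k, ∑ a, ∑ b, Function.update v i x (l k) a * w a b * Function.update v i x (r k) b =
      L x := by
    intro v i
    have hW : i ∈ Set.range l ∪ Set.range r → ∀ x,
        W (fun z => Function.update v i x z) = W (fun z => v z) := by
      intro hi x
      congr 1
      funext z
      refine Function.update_of_ne (fun h => z.2 ?_) _ _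
      rwa [h]
    have split : ∀ a x, ∏ k, ∑ i', ∑ j', Function.update v i x (l k) i' * w i' j' *
          Function.update v i x (r k) j' =
        (∑ i', ∑ j', Function.update v i x (l a) i' * w i' j' * Function.update v i x (r a) j') *
          ∏ k ∈ Finset.univ.erase a, ∑ i', ∑ j', Function.update v i x (l k) i' * w i' j' *
            Function.update v i x (r k) j' :=
      fun a x => (Finset.mul_prod_erase _ _ (Finset.mem_univ a)).symm
    by_cases hl : i ∈ Set.range l
    · obtain ⟨a, rfl⟩ := hl
      refine ⟨∑ i', (W (fun z => v z) * (∑ j', w i' j' * v (r a) j') *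
        ∏ k ∈ Finset.univ.erase a, ∑ i', ∑ j', v (l k) i' * w i' j' * v (r k) j') •
          LinearMap.proj i', fun x => ?_⟩
      have : ∏ k ∈ Finset.univ.erase a, ∑ i', ∑ j', Function.update v (l a) x (l k) i' *
          w i' j' * Function.update v (l a) x (r k) j' =
          ∏ k ∈ Finset.univ.erase a, ∑ i', ∑ j', v (l k) i' * w i' j' * v (r k) j' := by
        refine Finset.prod_congr rfl fun k hk => ?_
        rw [Function.update_of_ne (l.injective.ne (Finset.ne_of_mem_erase hk)),
          Function.update_of_ne (hlr a k).symm]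
      rw [hW (Or.inl ⟨a, rfl⟩), split a, this, Function.update_self,
        Function.update_of_ne (hlr a a).symm]
      simp only [LinearMap.sum_apply, LinearMap.smul_apply, LinearMap.proj_apply, smul_eq_mul]
      rw [Finset.sum_mul, Finset.mul_sum]
      refine Finset.sum_congr rfl fun i' _ => ?_
      simp only [mul_assoc, ← Finset.mul_sum]
      ring
    by_cases hr : i ∈ Set.range r
    · obtain ⟨a, rfl⟩ := hr
      refine ⟨∑ j', (W (fun z => v z) * (∑ i', v (l a) i' * w i' j') *
        ∏ k ∈ Finset.univ.erase a, ∑ i', ∑ j', v (l k) i' * w i' j' * v (r k) j') •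
          LinearMap.proj j', fun x => ?_⟩
      have : ∏ k ∈ Finset.univ.erase a, ∑ i', ∑ j', Function.update v (r a) x (l k) i' *
          w i' j' * Function.update v (r a) x (r k) j' =
          ∏ k ∈ Finset.univ.erase a, ∑ i', ∑ j', v (l k) i' * w i' j' * v (r k) j' := by
        refine Finset.prod_congr rfl fun k hk => ?_
        rw [Function.update_of_ne (r.injective.ne (Finset.ne_of_mem_erase hk)),
          Function.update_of_ne (hlr k a)]
      rw [hW (Or.inr ⟨a, rfl⟩), split a, this, Function.update_self,
        Function.update_of_ne (hlr a a), Finset.sum_comm]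
      simp only [LinearMap.sum_apply, LinearMap.smul_apply, LinearMap.proj_apply, smul_eq_mul]
      rw [Finset.sum_mul, Finset.mul_sum]
      refine Finset.sum_congr rfl fun j' _ => ?_
      simp only [← Finset.sum_mul]
      ring
    · have hi : i ∉ Set.range l ∪ Set.range r := fun h => h.elim hl hr
      refine ⟨(∏ k, ∑ i', ∑ j', v (l k) i' * w i' j' * v (r k) j') •
        W.toLinearMap (fun z => v z) ⟨i, hi⟩, fun x => ?_⟩
      have h1 : (fun z : {i : ι // i ∉ Set.range l ∪ Set.range r} =>
          Function.update v i x (z : ι)) = Function.update (fun z : {i : ι // i ∉ Set.range l ∪ Set.range r} => v z) ⟨i, hi⟩ x := by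
        funext z
        by_cases hz : z = ⟨i, hi⟩
        · subst hz; simp
        · rw [Function.update_of_ne hz, Function.update_of_ne (fun h => hz (Subtype.ext h))]
      have h2 : ∀ k, l k ≠ i := fun k h => hl ⟨k, h⟩
      have h3 : ∀ k, r k ≠ i := fun k h => hr ⟨k, h⟩
      simp only [h1, Function.update_of_ne (h2 _), Function.update_of_ne (h3 _),
        LinearMap.smul_apply, MultilinearMap.toLinearMap_apply, smul_eq_mul]
      ring
  { toFun := fun v => W (fun z => v z) * ∏ k, ∑ a, ∑ b, v (l k) a * w a b * v (r k) b
    map_update_add' := by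
      intro _ v i x y
      obtain ⟨L, hL⟩ := key v i
      convert L.map_add x y using 1
      · convert hL (x + y)
      · congr 1
        · convert hL x
        · convert hL y
    map_update_smul' := by
      intro _ v i c x
      obtain ⟨L, hL⟩ := key v i
      convert L.map_smul c x using 1
      · convert hL (c • x)
      · congr 1
        convert hL x }

/-- Transformation law of pair sums under a change of frame `v`. -/
theorem sum_sign_pairForm (hlr : ∀ a b, l a ≠ r b)
    (W : MultilinearMap ℝ (fun _ : {i : ι // i ∉ Set.range l ∪ Set.range r} => ι → ℝ) ℝ)
    (w : ι → ι → ℝ) (v : ι → ι → ℝ) :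
    pairSum l r (fun σ => W fun z => v (σ z)) (fun _ i j => ∑ a, ∑ b, v i a * w a b * v j b) =
      (Matrix.of v).det * pairSum l r (fun σ => W fun z => Pi.single (σ z) 1) (fun _ => w) := by
  -- The alternatization is an alternating form of top degree, hence its value on the standard basis
  -- times the determinant.
  have h := congrArg (fun f => f v) (AlternatingMap.eq_smul_basis_det (Pi.basisFun ℝ ι)
    (MultilinearMap.alternatization (pairForm hlr W w)))
  rw [AlternatingMap.smul_apply, Pi.basisFun_det, MultilinearMap.alternatization_apply,
    MultilinearMap.alternatization_apply] at h
  simp only [MultilinearMap.domDomCongr_apply, pairForm, MultilinearMap.coe_mk, Pi.basisFun_apply,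
    Units.smul_def, zsmul_eq_mul, smul_eq_mul] at h
  unfold pairSum
  rw [h, mul_comm]
  congr 1
  refine Finset.sum_congr rfl fun σ _ => ?_
  simp [Pi.single_apply]

end PairSum

end CompressibleFlow

namespace CompressibleFlow

/-! ### Evaluation of the pair sum on the standard block matrix. -/

section Block

variable {ι κ : Type*} [Fintype ι] [DecidableEq ι] [Fintype κ] [DecidableEq κ] {l r : κ ↪ ι}

/-- The matrix whose nonzero entries are `1` at the positions `(l k, r k)`. -/
noncomputable def pairMatrix (l r : κ ↪ ι) (i j : ι) : ℝ := if ∃ k, i = l k ∧ j = r k then 1 else 0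

omit [Fintype ι] [DecidableEq κ] in
theorem pairMatrix_nonneg (i j : ι) : 0 ≤ pairMatrix l r i j := by
  unfold pairMatrix; split_ifs <;> norm_num

omit [Fintype ι] [DecidableEq κ] in
-- A nonzero product forces `σ` to send each pair `(l k, r k)` to such a pair in the same order.
-- Thus `σ` is one permutation `π` of the pairs, performed once on the left and once on the right
-- slots; this form shows at once that `σ` is even.
theorem exists_eq_of_prod_pairMatrix_ne_zero (hlr : ∀ a b, l a ≠ r b)
    (hrest : ∀ i j, i ∉ Set.range l ∪ Set.range r → j ∉ Set.range l ∪ Set.range r → i = j)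
    {σ : Equiv.Perm ι} (h : ∏ k, pairMatrix l r (σ (l k)) (σ (r k)) ≠ 0) :
    ∃ π : Equiv.Perm κ, σ = π.viaFintypeEmbedding l * π.viaFintypeEmbedding r := by
  have h1 : ∀ k, ∃ k', σ (l k) = l k' ∧ σ (r k) = r k' := by
    intro k
    by_contra hk
    exact Finset.prod_ne_zero_iff.mp h k (Finset.mem_univ k) (if_neg hk)
  choose p hpl hpr using h1
  have hp : Function.Injective p := fun a b hab => by
    apply l.injective
    apply σ.injective
    rw [hpl, hpl, hab]
  refine ⟨Equiv.ofBijective p (Finite.injective_iff_bijective.mp hp), ?_⟩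
  set π : Equiv.Perm κ := Equiv.ofBijective p (Finite.injective_iff_bijective.mp hp)
  have hπl : ∀ k, (π.viaFintypeEmbedding l * π.viaFintypeEmbedding r) (l k) = σ (l k) := by
    intro k
    rw [Equiv.Perm.mul_apply, Equiv.Perm.viaFintypeEmbedding_apply_notMem_range (f := r),
      Equiv.Perm.viaFintypeEmbedding_apply_image, hpl]
    · rfl
    · rintro ⟨b, hb⟩
      exact hlr k b hb.symm
  have hπr : ∀ k, (π.viaFintypeEmbedding l * π.viaFintypeEmbedding r) (r k) = σ (r k) := by
    intro k
    rw [Equiv.Perm.mul_apply, Equiv.Perm.viaFintypeEmbedding_apply_image,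
      Equiv.Perm.viaFintypeEmbedding_apply_notMem_range, hpr]
    · rfl
    · rintro ⟨b, hb⟩
      exact hlr b _ hb
  -- A permutation carrying pairs to pairs is onto the paired indices, so it preserves their
  -- complement, which has at most one point.
  have hfix : ∀ τ : Equiv.Perm ι, (∀ k, ∃ k', τ (l k) = l k' ∧ τ (r k) = r k') →
      ∀ i, i ∉ Set.range l ∪ Set.range r → τ i ∉ Set.range l ∪ Set.range r := by
    intro τ hτ i hi hmem
    choose q hql hqr using hτ
    have hq : Function.Injective q := fun a b hab => by
      apply l.injective
      apply τ.injective
      rw [hql, hql, hab]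
    have hq := (Finite.injective_iff_bijective.mp hq).2
    rcases hmem with ⟨k, hk⟩ | ⟨k, hk⟩
    · obtain ⟨k, rfl⟩ := hq k
      exact hi (Or.inl ⟨k, τ.injective (by rw [hql, hk])⟩)
    · obtain ⟨k, rfl⟩ := hq k
      exact hi (Or.inr ⟨k, τ.injective (by rw [hqr, hk])⟩)
  ext i
  by_cases hi : i ∈ Set.range l ∪ Set.range r
  · rcases hi with ⟨k, rfl⟩ | ⟨k, rfl⟩
    · rw [hπl]
    · rw [hπr]
  · exact hrest _ _ (hfix σ (fun k => ⟨p k, hpl k, hpr k⟩) i hi)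
      (hfix _ (fun k => ⟨p k, by rw [hπl, hpl], by rw [hπr, hpr]⟩) i hi)

/-- Every contributing permutation has sign `sign π * sign π = 1`, so no cancellation can occur. -/
theorem pairSum_pairMatrix (hlr : ∀ a b, l a ≠ r b)
    (hrest : ∀ i j, i ∉ Set.range l ∪ Set.range r → j ∉ Set.range l ∪ Set.range r → i = j)
    (W : (ι → ι) → ℝ) :
    pairSum l r W (fun _ => pairMatrix l r) =
      ∑ σ : Equiv.Perm ι, W σ * ∏ k, pairMatrix l r (σ (l k)) (σ (r k)) := by
  refine Finset.sum_congr rfl fun σ _ => ?_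
  by_cases h : ∏ k, pairMatrix l r (σ (l k)) (σ (r k)) = 0
  · simp [h]
  · obtain ⟨π, hπ⟩ := exists_eq_of_prod_pairMatrix_ne_zero hlr hrest h
    have : Equiv.Perm.sign σ = 1 := by
      rw [hπ, Equiv.Perm.sign_mul, Equiv.Perm.viaFintypeEmbedding_sign,
        Equiv.Perm.viaFintypeEmbedding_sign, Int.units_mul_self]
    simp [this]

theorem pairSum_pairMatrix_pos (hlr : ∀ a b, l a ≠ r b)
    (hrest : ∀ i j, i ∉ Set.range l ∪ Set.range r → j ∉ Set.range l ∪ Set.range r → i = j)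
    {W : (ι → ι) → ℝ} (hW : ∀ σ : Equiv.Perm ι, 0 ≤ W σ) (hW1 : 0 < W id) :
    0 < pairSum l r W (fun _ => pairMatrix l r) := by
  rw [pairSum_pairMatrix hlr hrest]
  refine Finset.sum_pos' (fun σ _ => mul_nonneg (hW σ)
    (Finset.prod_nonneg fun k _ => pairMatrix_nonneg _ _)) ⟨1, Finset.mem_univ _, ?_⟩
  refine mul_pos hW1 (Finset.prod_pos fun k _ => ?_)
  rw [pairMatrix, if_pos ⟨k, rfl, rfl⟩]
  exact one_pos

/-- The contributing permutations fix the unpaired index `z`, so only values of `W` at such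
permutations matter. -/
theorem pairSum_pairMatrix_eq_zero (hlr : ∀ a b, l a ≠ r b)
    (hrest : ∀ i j, i ∉ Set.range l ∪ Set.range r → j ∉ Set.range l ∪ Set.range r → i = j)
    {W : (ι → ι) → ℝ} {z : ι} (hz : z ∉ Set.range l ∪ Set.range r)
    (hW : ∀ σ : Equiv.Perm ι, σ z = z → W σ = 0) :
    pairSum l r W (fun _ => pairMatrix l r) = 0 := by
  rw [pairSum_pairMatrix hlr hrest]
  refine Finset.sum_eq_zero fun σ _ => ?_
  by_cases h : ∏ k, pairMatrix l r (σ (l k)) (σ (r k)) = 0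
  · rw [h, mul_zero]
  · obtain ⟨π, hπ⟩ := exists_eq_of_prod_pairMatrix_ne_zero hlr hrest h
    rw [hW, zero_mul]
    rw [hπ, Equiv.Perm.mul_apply, Equiv.Perm.viaFintypeEmbedding_apply_notMem_range
      (h := fun h => hz (Or.inr h)), Equiv.Perm.viaFintypeEmbedding_apply_notMem_range
      (h := fun h => hz (Or.inl h))]

omit [DecidableEq κ] in
theorem contDiff_pairSum (W : (ι → ι) → ℝ) :
    ContDiff ℝ ∞ fun w : ι → ι → ℝ => pairSum l r W fun _ => w := by
  refine ContDiff.sum fun σ _ => contDiff_const.mul (contDiff_const.mul ?_)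
  exact contDiff_prod fun k _ => contDiff_apply_apply ℝ ℝ _ _

end Block

/-! ### The vorticity as a function of the curl -/

/-- The even slots `2k` of `Fin (2m)`. -/
def evenLeft (m : ℕ) : Fin m ↪ Fin (2 * m) :=
  ⟨fun k => ⟨2 * k, by omega⟩, fun a b h => by simp only [Fin.mk.injEq] at h; omega⟩

/-- The odd slots `2k + 1` of `Fin (2m)`. -/
def evenRight (m : ℕ) : Fin m ↪ Fin (2 * m) :=
  ⟨fun k => ⟨2 * k + 1, by omega⟩, fun a b h => by simp only [Fin.mk.injEq] at h; omega⟩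

/-- The slots `2k + 1` of `Fin (2m + 1)`. -/
def oddLeft (m : ℕ) : Fin m ↪ Fin (2 * m + 1) :=
  ⟨fun k => ⟨2 * k + 1, by omega⟩, fun a b h => by simp only [Fin.mk.injEq] at h; omega⟩

/-- The slots `2k + 2` of `Fin (2m + 1)`. -/
def oddRight (m : ℕ) : Fin m ↪ Fin (2 * m + 1) :=
  ⟨fun k => ⟨2 * k + 2, by omega⟩, fun a b h => by simp only [Fin.mk.injEq] at h; omega⟩

@[simp] theorem evenLeft_val {m : ℕ} (k : Fin m) : (evenLeft m k : ℕ) = 2 * k := rfl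

@[simp] theorem evenRight_val {m : ℕ} (k : Fin m) : (evenRight m k : ℕ) = 2 * k + 1 := rfl

@[simp] theorem oddLeft_val {m : ℕ} (k : Fin m) : (oddLeft m k : ℕ) = 2 * k + 1 := rfl

@[simp] theorem oddRight_val {m : ℕ} (k : Fin m) : (oddRight m k : ℕ) = 2 * k + 2 := rfl

theorem evenLeft_ne_evenRight {m : ℕ} (a b : Fin m) : evenLeft m a ≠ evenRight m b := by
  rw [ne_eq, Fin.ext_iff, evenLeft_val, evenRight_val]; omega

theorem oddLeft_ne_oddRight {m : ℕ} (a b : Fin m) : oddLeft m a ≠ oddRight m b := by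
  rw [ne_eq, Fin.ext_iff, oddLeft_val, oddRight_val]; omega

theorem mem_range_even {m : ℕ} (i : Fin (2 * m)) :
    i ∈ Set.range (evenLeft m) ∪ Set.range (evenRight m) := by
  obtain ⟨k, h | h⟩ := Nat.even_or_odd' i.1
  · exact Or.inl ⟨⟨k, by omega⟩, Fin.ext h.symm⟩
  · exact Or.inr ⟨⟨k, by omega⟩, Fin.ext h.symm⟩

theorem notMem_range_odd_iff {m : ℕ} (i : Fin (2 * m + 1)) :
    i ∉ Set.range (oddLeft m) ∪ Set.range (oddRight m) ↔ i = 0 := by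
  constructor
  · intro h
    by_contra h0
    have h0 : i.1 ≠ 0 := fun h => h0 (Fin.ext h)
    obtain ⟨k, h' | h'⟩ := Nat.even_or_odd' i.1
    · exact h (Or.inr ⟨⟨k - 1, by omega⟩, Fin.ext (by rw [oddRight_val, h']; grind)⟩)
    · exact h (Or.inl ⟨⟨k, by omega⟩, Fin.ext (by rw [oddLeft_val, h'])⟩)
  · rintro rfl (⟨k, hk⟩ | ⟨k, hk⟩)
    · have := congrArg Fin.val hk; rw [oddLeft_val, Fin.val_zero] at this; omega
    · have := congrArg Fin.val hk; rw [oddRight_val, Fin.val_zero] at this; omega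

/-- The vorticity scalar as a function of the curl. -/
noncomputable def scalarForm (m : ℕ) (w : Fin (2 * m) → Fin (2 * m) → ℝ) : ℝ :=
  pairSum (evenLeft m) (evenRight m) (fun _ => 1) fun _ => w

/-- The vorticity vector as a function of the curl. -/
noncomputable def vectorForm (m : ℕ) (w : Fin (2 * m + 1) → Fin (2 * m + 1) → ℝ) :
    Space (2 * m + 1) :=
  WithLp.toLp 2 fun i =>
    pairSum (oddLeft m) (oddRight m) (fun σ => if σ 0 = i then 1 else 0) fun _ => w

theorem vectorForm_apply (m : ℕ) (w : Fin (2 * m + 1) → Fin (2 * m + 1) → ℝ)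
    (i : Fin (2 * m + 1)) : vectorForm m w i =
      pairSum (oddLeft m) (oddRight m) (fun σ => if σ 0 = i then 1 else 0) fun _ => w := rfl

theorem vorticityScalar_eq (m : ℕ) (u : Space (2 * m) → Space (2 * m)) (x : Space (2 * m)) :
    vorticityScalar m u x = scalarForm m (curl u x) := by
  simp only [scalarForm, pairSum, one_mul]
  rfl

theorem vorticityVector_eq (m : ℕ) (u : Space (2 * m + 1) → Space (2 * m + 1))
    (x : Space (2 * m + 1)) : vorticityVector m u x = vectorForm m (curl u x) := by
  ext i
  simp only [vectorForm, vorticityVector, pairSum]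
  refine Finset.sum_congr rfl fun σ _ => ?_
  split_ifs
  · rw [one_mul]; rfl
  · simp

theorem contDiff_scalarForm (m : ℕ) : ContDiff ℝ ∞ (scalarForm m) := contDiff_pairSum _

theorem contDiff_vectorForm (m : ℕ) : ContDiff ℝ ∞ (vectorForm m) := by
  rw [contDiff_euclidean]
  intro i
  simp only [vectorForm_apply]
  exact contDiff_pairSum _

theorem scalarForm_skewPart (m : ℕ) (A : Fin (2 * m) → Fin (2 * m) → ℝ) :
    scalarForm m (skewPart A) = scalarForm m A :=
  pairSum_skewPart evenLeft_ne_evenRight (fun _ _ => rfl) fun _ => A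

theorem vectorForm_skewPart (m : ℕ) (A : Fin (2 * m + 1) → Fin (2 * m + 1) → ℝ) :
    vectorForm m (skewPart A) = vectorForm m A := by
  ext i
  rw [vectorForm_apply, vectorForm_apply]
  refine pairSum_skewPart oddLeft_ne_oddRight (fun σ a => ?_) fun _ => A
  rw [Equiv.Perm.mul_apply, Equiv.swap_apply_of_ne_of_ne]
  · exact fun h => (notMem_range_odd_iff 0).2 rfl (Or.inl ⟨a, h.symm⟩)
  · exact fun h => (notMem_range_odd_iff 0).2 rfl (Or.inr ⟨a, h.symm⟩)

/-- All indices are paired, so the form `W` has no arguments and is the constant 1. This is the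
Pfaffian identity Pf(M w Mᵀ) = det M · Pf w, up to normalization. -/
theorem scalarForm_conj (m : ℕ) (w : Fin (2 * m) → Fin (2 * m) → ℝ)
    (M : Matrix (Fin (2 * m)) (Fin (2 * m)) ℝ) :
    scalarForm m (fun i j => ∑ a, ∑ b, M i a * w a b * M j b) = M.det * scalarForm m w := by
  have : IsEmpty {i // i ∉ Set.range (evenLeft m) ∪ Set.range (evenRight m)} :=
    ⟨fun i => i.2 (mem_range_even i.1)⟩
  exact sum_sign_pairForm evenLeft_ne_evenRight
    (MultilinearMap.constOfIsEmpty ℝ _ (1 : ℝ)) w M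

/-- The index 0 is the only free slot; taking `W` to be the `c`-th coordinate of the vector in that
slot produces the contraction with column `c` of `M`. -/
theorem vectorForm_conj (m : ℕ) (w : Fin (2 * m + 1) → Fin (2 * m + 1) → ℝ)
    (M : Matrix (Fin (2 * m + 1)) (Fin (2 * m + 1)) ℝ) (c : Fin (2 * m + 1)) :
    ∑ i, M i c * vectorForm m (fun i j => ∑ a, ∑ b, M i a * w a b * M j b) i =
      M.det * vectorForm m w c := by
  have h0 : (0 : Fin (2 * m + 1)) ∉ Set.range (oddLeft m) ∪ Set.range (oddRight m) :=
    (notMem_range_odd_iff 0).2 rfl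
  have : Subsingleton {i // i ∉ Set.range (oddLeft m) ∪ Set.range (oddRight m)} :=
    ⟨fun i j => Subtype.ext (((notMem_range_odd_iff _).1 i.2).trans
      ((notMem_range_odd_iff _).1 j.2).symm)⟩
  have h := sum_sign_pairForm oddLeft_ne_oddRight
    (MultilinearMap.ofSubsingleton ℝ (Fin (2 * m + 1) → ℝ) ℝ
      (⟨0, h0⟩ : {i // i ∉ Set.range (oddLeft m) ∪ Set.range (oddRight m)})
      (LinearMap.proj c)) w M
  simp only [MultilinearMap.ofSubsingleton_apply_apply, LinearMap.proj_apply] at h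
  have e : ∀ (N : Fin (2 * m + 1) → Fin (2 * m + 1) → ℝ),
      ∑ i, M i c * vectorForm m N i = pairSum (oddLeft m) (oddRight m)
        (fun σ => M (σ 0) c) fun _ => N := by
    intro N
    simp only [vectorForm, pairSum, Finset.mul_sum]
    rw [Finset.sum_comm]
    refine Finset.sum_congr rfl fun σ _ => ?_
    rw [Finset.sum_eq_single (σ 0)]
    · rw [if_pos rfl]; ring
    · intro i _ hi
      rw [if_neg hi.symm]; ring
    · simp
  rw [e]
  refine h.trans ?_
  congr 1
  simp only [vectorForm, Pi.single_apply]
  congr 1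
  funext σ
  simp [eq_comm]

theorem scalarForm_pairMatrix_pos (m : ℕ) :
    0 < scalarForm m (pairMatrix (evenLeft m) (evenRight m)) :=
  pairSum_pairMatrix_pos evenLeft_ne_evenRight (fun i _ hi => (hi (mem_range_even i)).elim)
    (fun _ => zero_le_one) one_pos

theorem vectorForm_pairMatrix_zero_pos (m : ℕ) :
    0 < vectorForm m (pairMatrix (oddLeft m) (oddRight m)) 0 := by
  rw [vectorForm_apply]
  refine pairSum_pairMatrix_pos oddLeft_ne_oddRight
    (fun i j hi hj => ((notMem_range_odd_iff i).1 hi).trans ((notMem_range_odd_iff j).1 hj).symm)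
    (fun σ => ?_) (by simp)
  split_ifs <;> norm_num

theorem vectorForm_pairMatrix_of_ne (m : ℕ) {i : Fin (2 * m + 1)} (hi : i ≠ 0) :
    vectorForm m (pairMatrix (oddLeft m) (oddRight m)) i = 0 := by
  rw [vectorForm_apply]
  refine pairSum_pairMatrix_eq_zero oddLeft_ne_oddRight
    (fun i j hi hj => ((notMem_range_odd_iff i).1 hi).trans ((notMem_range_odd_iff j).1 hj).symm)
    ((notMem_range_odd_iff 0).2 rfl) fun σ hσ => ?_
  rw [hσ, if_neg hi.symm]

end CompressibleFlow

/-! ### Infinitesimal form of the transformation laws. -/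

namespace CompressibleFlow

section

variable {ι : Type*} [Fintype ι]

/-- The derivative of `(1 + tA)ᵀ w (1 + tA)` at `t = 0`, that is `Aᵀ w + w A`. -/
noncomputable def lieAction (A w : ι → ι → ℝ) (i j : ι) : ℝ :=
  ∑ a, A a i * w a j + ∑ b, w i b * A b j

theorem conj_one_add_smul [DecidableEq ι] (A w : ι → ι → ℝ) (t : ℝ) :
    (fun i j => ∑ a, ∑ b, (1 + t • Matrix.of fun i a => A a i : Matrix ι ι ℝ) i a * w a b *
      (1 + t • Matrix.of fun i a => A a i : Matrix ι ι ℝ) j b) =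
    w + t • lieAction A w + t ^ 2 • fun i j => ∑ a, ∑ b, A a i * w a b * A b j := by
  funext i j
  simp only [Matrix.add_apply, Matrix.one_apply, Matrix.smul_apply, Matrix.of_apply, smul_eq_mul,
    Pi.add_apply, Pi.smul_apply, lieAction]
  have : ∀ a b, ((if i = a then 1 else 0) + t * A a i) * w a b * ((if j = b then 1 else 0) +
      t * A b j) = (if i = a then (if j = b then w a b else 0) else 0) +
      (if j = b then t * (A a i * w a b) else 0) + (if i = a then t * (w a b * A b j) else 0) +
      t ^ 2 * (A a i * w a b * A b j) := by
    intro a b; split_ifs <;> ring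
  simp only [this, Finset.sum_add_distrib, Finset.sum_ite_eq, Finset.mem_univ, if_true,
    ← Finset.mul_sum, Finset.sum_ite_irrel, Finset.sum_const_zero]
  ring

theorem hasDerivAt_conj_one_add_smul {V : Type*} [NormedAddCommGroup V] [NormedSpace ℝ V]
    [DecidableEq ι] {F : (ι → ι → ℝ) → V} (hF : Differentiable ℝ F) (A w : ι → ι → ℝ) :
    HasDerivAt (fun t : ℝ => F fun i j =>
      ∑ a, ∑ b, (1 + t • Matrix.of fun i a => A a i : Matrix ι ι ℝ) i a * w a b *
        (1 + t • Matrix.of fun i a => A a i : Matrix ι ι ℝ) j b)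
      (fderiv ℝ F w (lieAction A w)) 0 := by
  simp only [conj_one_add_smul]
  set Y : ι → ι → ℝ := fun i j => ∑ a, ∑ b, A a i * w a b * A b j
  have h1 : HasDerivAt (fun t : ℝ => w + t • lieAction A w + t ^ 2 • Y) (lieAction A w) 0 := by
    have := (((hasDerivAt_id' (0 : ℝ)).smul_const (lieAction A w)).const_add w).fun_add
      (((hasDerivAt_id' (0 : ℝ)).fun_pow 2).smul_const Y)
    simpa using this
  have h2 : HasFDerivAt F (fderiv ℝ F w)
      (w + (0 : ℝ) • lieAction A w + (0 : ℝ) ^ 2 • Y) := by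
    simpa using (hF w).hasFDerivAt
  exact h2.comp_hasDerivAt 0 h1

/-- The determinant is 1 + t tr A plus t² times a polynomial in t, so only the trace survives at t =
0. -/
theorem hasDerivAt_det_one_add_smul [DecidableEq ι] (A : ι → ι → ℝ) :
    HasDerivAt (fun t : ℝ => (1 + t • Matrix.of fun i a => A a i : Matrix ι ι ℝ).det)
      (∑ i, A i i) 0 := by
  have h : HasDerivAt (fun t : ℝ => 1 + (∑ i, A i i) * t +
      (Matrix.det (1 + (Polynomial.X : Polynomial ℝ) •
        (Matrix.of fun i a => A a i).map Polynomial.C)).divX.divX.eval t * t ^ 2)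
      (∑ i, A i i) 0 := by
    have := (((hasDerivAt_id' (0 : ℝ)).const_mul (∑ i, A i i)).const_add 1).fun_add
      ((Polynomial.hasDerivAt (Matrix.det (1 + (Polynomial.X : Polynomial ℝ) •
        (Matrix.of fun i a => A a i).map Polynomial.C)).divX.divX 0).fun_mul
          ((hasDerivAt_id' (0 : ℝ)).fun_pow 2))
    simpa using this
  refine h.congr_of_eventuallyEq (Filter.Eventually.of_forall fun t => ?_)
  dsimp only
  rw [Matrix.det_one_add_smul]
  rfl

omit [Fintype ι] in
theorem skewPart_add_symm (A E : ι → ι → ℝ) (hE : ∀ i j, E i j = E j i) :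
    skewPart (A + E) = skewPart A := by
  funext i j
  simp only [skewPart, Pi.add_apply, hE i j]
  ring

omit [Fintype ι] in
theorem skewPart_add_smul (A E : ι → ι → ℝ) (t : ℝ) :
    skewPart (A + t • E) = skewPart A + t • skewPart E := by
  funext i j
  simp only [skewPart, Pi.add_apply, Pi.smul_apply, smul_eq_mul]
  ring

omit [Fintype ι] in
theorem skewPart_skewPart (A : ι → ι → ℝ) : skewPart (skewPart A) = skewPart A := by
  funext i j
  simp only [skewPart]
  ring

theorem sum_skewPart_diag (A : ι → ι → ℝ) : ∑ i, skewPart A i i = 0 := by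
  simp [skewPart]

end

/-- Derivative of `scalarForm_conj` at the identity. It makes the scalar vorticity obey, apart from
the baroclinic term, the same continuity equation as the density. -/
theorem fderiv_scalarForm_lieAction (m : ℕ) (A w : Fin (2 * m) → Fin (2 * m) → ℝ) :
    fderiv ℝ (scalarForm m) w (lieAction A w) = (∑ i, A i i) * scalarForm m w := by
  have h1 := hasDerivAt_conj_one_add_smul
    ((contDiff_scalarForm m).differentiable (by simp)) A w
  simp only [scalarForm_conj] at h1
  exact h1.unique ((hasDerivAt_det_one_add_smul A).mul_const _)

/-- Derivative of `vectorForm_conj` at the identity. The product rule on the left side leaves the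
vortex stretching term `A ϖ`, which is what rules out conserved densities in odd dimension. -/
theorem fderiv_vectorForm_lieAction (m : ℕ) (A w : Fin (2 * m + 1) → Fin (2 * m + 1) → ℝ)
    (c : Fin (2 * m + 1)) :
    fderiv ℝ (vectorForm m) w (lieAction A w) c =
      (∑ i, A i i) * vectorForm m w c - ∑ i, A c i * vectorForm m w i := by
  have h1 : ∀ i, HasDerivAt (fun t : ℝ => vectorForm m (fun i j =>
        ∑ a, ∑ b, (1 + t • Matrix.of fun i a => A a i : Matrix _ _ ℝ) i a * w a b *
        (1 + t • Matrix.of fun i a => A a i : Matrix _ _ ℝ) j b) i)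
      (fderiv ℝ (vectorForm m) w (lieAction A w) i) 0 := fun i =>
    (EuclideanSpace.proj i : Space (2 * m + 1) →L[ℝ] ℝ).hasFDerivAt.comp_hasDerivAt (0 : ℝ)
      (hasDerivAt_conj_one_add_smul ((contDiff_vectorForm m).differentiable (by simp)) A w)
  have h2 : HasDerivAt (fun t : ℝ => ∑ i,
      (1 + t • Matrix.of fun i a => A a i : Matrix _ _ ℝ) i c * vectorForm m (fun i j =>
        ∑ a, ∑ b, (1 + t • Matrix.of fun i a => A a i : Matrix _ _ ℝ) i a * w a b *
        (1 + t • Matrix.of fun i a => A a i : Matrix _ _ ℝ) j b) i)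
      (∑ i, (A c i * vectorForm m w i + (if i = c then 1 else 0) *
        fderiv ℝ (vectorForm m) w (lieAction A w) i)) 0 := by
    refine HasDerivAt.fun_sum fun i _ => ?_
    have h3 : HasDerivAt (fun t : ℝ => (1 + t • Matrix.of fun i a => A a i : Matrix _ _ ℝ) i c)
        (A c i) 0 := by
      simp only [Matrix.add_apply, Matrix.smul_apply, Matrix.of_apply, smul_eq_mul]
      simpa using ((hasDerivAt_id' (0 : ℝ)).mul_const (A c i)).const_add
        ((1 : Matrix (Fin (2 * m + 1)) (Fin (2 * m + 1)) ℝ) i c)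
    have h4 := h3.fun_mul (h1 i)
    have h5 : (fun i j => ∑ a, ∑ b, (1 + (0 : ℝ) • Matrix.of fun i a => A a i : Matrix _ _ ℝ) i a *
        w a b * (1 + (0 : ℝ) • Matrix.of fun i a => A a i : Matrix _ _ ℝ) j b) = w := by
      rw [conj_one_add_smul]; simp
    have h6 : (1 + (0 : ℝ) • Matrix.of fun i a => A a i : Matrix _ _ ℝ) i c =
        if i = c then 1 else 0 := by
      simp [Matrix.one_apply]
    rw [h5, h6] at h4
    exact h4
  simp only [vectorForm_conj] at h2
  have h3 := h2.unique ((hasDerivAt_det_one_add_smul A).mul_const (vectorForm m w c))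
  simp only [Finset.sum_add_distrib, ite_mul, one_mul, zero_mul, Finset.sum_ite_eq',
    Finset.mem_univ, if_true] at h3
  linarith

/-! ### Velocity gradients realizing a prescribed vorticity. -/

/-- The matrix unit at position `(0, 1)`. -/
def matrixUnit (n : ℕ) (i j : Fin n) : ℝ := if i.1 = 0 ∧ j.1 = 1 then 1 else 0

/-- Changing the `(0, 1)` entry of the block matrix from 1 to `1 + c` is the congruence by diag(1 +
c, 1, …, 1), since row 0 has no other nonzero entry and column 0 vanishes. -/
theorem scalarForm_pairMatrix_add (m : ℕ) (hm : 1 ≤ m) (c : ℝ) :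
    scalarForm m (pairMatrix (evenLeft m) (evenRight m) + c • matrixUnit (2 * m)) =
      (1 + c) * scalarForm m (pairMatrix (evenLeft m) (evenRight m)) := by
  have h := scalarForm_conj m (pairMatrix (evenLeft m) (evenRight m))
    (Matrix.diagonal fun i => if i.1 = 0 then 1 + c else 1)
  rw [Matrix.det_diagonal] at h
  have h1 : ∏ i : Fin (2 * m), (if i.1 = 0 then 1 + c else 1) = 1 + c := by
    rw [Finset.prod_eq_single (⟨0, by omega⟩ : Fin (2 * m))]
    · simp
    · intro b _ hb
      rw [if_neg fun h => hb (Fin.ext h)]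
    · simp
  rw [h1] at h
  rw [← h]
  congr 1
  funext i j
  simp only [Matrix.diagonal_apply, ite_mul, zero_mul, Finset.sum_ite_eq, Finset.mem_univ,
    if_true, mul_ite, mul_zero, Pi.add_apply, Pi.smul_apply, smul_eq_mul]
  simp only [matrixUnit, pairMatrix]
  by_cases hi : i.1 = 0
  · by_cases hj : j.1 = 1
    · have : ∃ k, i = evenLeft m k ∧ j = evenRight m k :=
        ⟨⟨0, by omega⟩, Fin.ext hi, Fin.ext hj⟩
      simp [hi, hj, this]
    · have : ¬ ∃ k, i = evenLeft m k ∧ j = evenRight m k := by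
        rintro ⟨k, h1, h2⟩
        have h1 := congrArg Fin.val h1
        have h2 := congrArg Fin.val h2
        rw [evenLeft_val] at h1
        rw [evenRight_val] at h2
        omega
      simp [hj, this]
  · by_cases hj : j.1 = 0
    · have : ¬ ∃ k, i = evenLeft m k ∧ j = evenRight m k := by
        rintro ⟨k, h1, h2⟩
        have h2 := congrArg Fin.val h2
        rw [evenRight_val] at h2
        omega
      simp [hi, this]
    · simp [hi, hj]

/-- The vorticity is affine in the `(0, 1)` entry with slope κ > 0, so every value is attained, zero
included, and always with nonzero derivative in that direction. This direction is the one later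
supplied by the baroclinic term. -/
theorem exists_scalarForm_skewPart_eq (m : ℕ) (hm : 1 ≤ m) (s : ℝ) :
    ∃ A : Fin (2 * m) → Fin (2 * m) → ℝ, ∑ i, A i i = 0 ∧ scalarForm m (skewPart A) = s ∧
      fderiv ℝ (scalarForm m) (skewPart A) (skewPart (matrixUnit (2 * m))) ≠ 0 := by
  set J := pairMatrix (evenLeft m) (evenRight m)
  set κ := scalarForm m J
  have hκ : 0 < κ := scalarForm_pairMatrix_pos m
  -- The `(0, 1)` entry becomes `s / κ`, which gives the value `s`.
  set B := J + (s / κ - 1) • matrixUnit (2 * m)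
  refine ⟨skewPart B, sum_skewPart_diag _, ?_, ?_⟩
  · rw [skewPart_skewPart, scalarForm_skewPart, scalarForm_pairMatrix_add m hm]
    field_simp
    ring
  · rw [skewPart_skewPart]
    have h1 : HasDerivAt (fun t : ℝ => scalarForm m (skewPart B + t • skewPart (matrixUnit _)))
        (fderiv ℝ (scalarForm m) (skewPart B) (skewPart (matrixUnit (2 * m)))) 0 := by
      have h2 : HasFDerivAt (scalarForm m) (fderiv ℝ (scalarForm m) (skewPart B))
          (skewPart B + (0 : ℝ) • skewPart (matrixUnit (2 * m))) := by
        simpa using ((contDiff_scalarForm m).differentiable (by simp) _).hasFDerivAt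
      have h3 : HasDerivAt (fun t : ℝ => skewPart B + t • skewPart (matrixUnit (2 * m)))
          (skewPart (matrixUnit (2 * m))) 0 := by
        simpa using ((hasDerivAt_id' (0 : ℝ)).smul_const
          (skewPart (matrixUnit (2 * m)))).const_add (skewPart B)
      exact h2.comp_hasDerivAt (0 : ℝ) h3
    have h2 : HasDerivAt (fun t : ℝ => scalarForm m (skewPart B + t • skewPart (matrixUnit _)))
        κ 0 := by
      have : ∀ t : ℝ, scalarForm m (skewPart B + t • skewPart (matrixUnit _)) =
          s + t * κ := by
        intro t
        rw [← skewPart_add_smul, scalarForm_skewPart]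
        have : B + t • matrixUnit (2 * m) = J + (s / κ - 1 + t) • matrixUnit (2 * m) := by
          rw [add_smul (s / κ - 1) t, ← add_assoc]
        rw [this, scalarForm_pairMatrix_add m hm]
        field_simp
        ring
      simp only [this]
      simpa using ((hasDerivAt_id' (0 : ℝ)).mul_const κ).const_add s
    rw [h1.unique h2]
    exact hκ.ne'

/-- The block matrix has vorticity κ e₀. A congruence by an invertible `M` moves it to `v` as soon
as vM = det M · κ e₀. -/
theorem exists_vectorForm_skewPart_eq (m : ℕ) (hm : 1 ≤ m) (v : Space (2 * m + 1))
    (hv : v 0 ≠ 0) :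
    ∃ A : Fin (2 * m + 1) → Fin (2 * m + 1) → ℝ,
      ∑ i, A i i = 0 ∧ vectorForm m (skewPart A) = v := by
  set J := pairMatrix (oddLeft m) (oddRight m)
  set κ := vectorForm m J 0
  have hκ : 0 < κ := vectorForm_pairMatrix_zero_pos m
  -- The single diagonal entry `v 0 / κ` at index 1 fixes the determinant so that det M · κ = v 0.
  set d : Fin (2 * m + 1) → ℝ := fun c => if c.1 = 1 then v 0 / κ else 1
  have h10 : (1 : Fin (2 * m + 1)) ≠ 0 := by
    intro h
    have := congrArg Fin.val h
    simp at this
    omega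
  -- Row 0 is chosen to annihilate all components of `v M` except the zeroth, so that `v M = v 0 ·
  -- e₀`; this is where `v 0 ≠ 0` is needed.
  set M : Matrix (Fin (2 * m + 1)) (Fin (2 * m + 1)) ℝ := Matrix.of fun i c =>
    if i = c then d c else if i = 0 then -(d c * v c / v 0) else 0
  have hdet : M.det = v 0 / κ := by
    rw [Matrix.det_of_isUpperTriangular]
    · simp only [M, Matrix.of_apply, if_true, d]
      rw [Finset.prod_eq_single (⟨1, by omega⟩ : Fin (2 * m + 1))]
      · simp
      · intro b _ hb
        rw [if_neg fun h => hb (Fin.ext h)]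
      · simp
    · intro i j hij
      have h1 : i ≠ j := fun h => by simp [h] at hij
      have h2 : i ≠ 0 := fun h => by simp [h] at hij
      simp [M, h1, h2]
  refine ⟨skewPart fun i j => ∑ a, ∑ b, M i a * J a b * M j b, sum_skewPart_diag _, ?_⟩
  rw [skewPart_skewPart, vectorForm_skewPart]
  set w := fun i j => ∑ a, ∑ b, M i a * J a b * M j b
  have hu : IsUnit M := (Matrix.isUnit_iff_isUnit_det M).2 (by
    rw [hdet]; exact (div_ne_zero hv hκ.ne').isUnit)
  have key : Matrix.vecMul (vectorForm m w).ofLp M = Matrix.vecMul v.ofLp M := by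
    funext c
    have h := vectorForm_conj m J M c
    simp only [Matrix.vecMul, dotProduct]
    have h' : ∑ i, vectorForm m w i * M i c = M.det * vectorForm m J c := by
      rw [← h]; exact Finset.sum_congr rfl fun i _ => mul_comm _ _
    refine h'.trans ?_
    rw [hdet]
    by_cases hc : c = 0
    · subst hc
      rw [Finset.sum_eq_single 0]
      · simp only [M, Matrix.of_apply, if_true, d, Fin.val_zero]
        change v 0 / κ * κ = _
        field_simp
        simp
      · intro i _ hi
        simp [M, hi]
      · simp
    · rw [vectorForm_pairMatrix_of_ne m hc, mul_zero]
      have : ∀ i, v i * M i c = (if i = c then v c * d c else 0) +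
          (if i = 0 then -(d c * v c) else 0) := by
        intro i
        by_cases h1 : i = c
        · subst h1
          simp [M, hc]
        · by_cases h2 : i = 0
          · subst h2
            simp only [M, Matrix.of_apply, if_neg h1, if_true]
            field_simp
            simp
          · simp [M, h1, h2]
      simp only [this, Finset.sum_add_distrib, Finset.sum_ite_eq', Finset.mem_univ, if_true]
      ring
  exact WithLp.ofLp_injective 2 (Matrix.vecMul_injective_iff_isUnit.2 hu key)

end CompressibleFlow

namespace CompressibleFlow

variable {n : ℕ}

/-! ### Derivatives of fields -/

/-- The velocity gradient `A i j = ∂_j u^i`. -/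
noncomputable def velocityGradient (u : Space n → Space n) (x : Space n) (i j : Fin n) : ℝ :=
  partialDeriv j u x i

theorem curl_eq_skewPart (u : Space n → Space n) (x : Space n) :
    curl u x = skewPart (velocityGradient u x) := rfl

theorem divergence_eq_sum (u : Space n → Space n) (x : Space n) :
    divergence u x = ∑ i, velocityGradient u x i i := rfl

theorem apply_eq_sum_single {F : Type*} [NormedAddCommGroup F] [NormedSpace ℝ F]
    (L : Space n →L[ℝ] F) (w : Space n) :
    L w = ∑ i, w i • L (EuclideanSpace.single i 1) := by
  conv_lhs => rw [← (EuclideanSpace.basisFun (Fin n) ℝ).sum_repr w]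
  simp

theorem fderiv_component {u : Space n → Space n} {x : Space n} (hu : DifferentiableAt ℝ u x)
    (i : Fin n) (w : Space n) : fderiv ℝ (fun y => u y i) x w = fderiv ℝ u x w i := by
  have h := ((EuclideanSpace.proj i : Space n →L[ℝ] ℝ).hasFDerivAt.comp x hu.hasFDerivAt).fderiv
  exact congrArg (fun L => L w) h

theorem gradient_apply (p : Space n → ℝ) (x : Space n) (i : Fin n) :
    gradient p x i = fderiv ℝ p x (EuclideanSpace.single i 1) := by
  have h : inner ℝ (gradient p x) (EuclideanSpace.single i (1 : ℝ)) =
      fderiv ℝ p x (EuclideanSpace.single i 1) := by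
    rw [gradient, InnerProductSpace.toDual_symm_apply]
  rw [← h, EuclideanSpace.inner_single_right]
  simp

theorem contDiff_fderiv {E F : Type*} [NormedAddCommGroup E] [NormedSpace ℝ E]
    [NormedAddCommGroup F] [NormedSpace ℝ F] {f : E → F} (hf : ContDiff ℝ ∞ f) :
    ContDiff ℝ ∞ (fderiv ℝ f) := hf.fderiv_right (by simp)

theorem contDiff_curl {u : Space n → Space n} (hu : ContDiff ℝ ∞ u) : ContDiff ℝ ∞ (curl u) := by
  rw [contDiff_pi]
  intro i
  rw [contDiff_pi]
  intro j
  have h : ∀ i j : Fin n, ContDiff ℝ ∞ fun x => partialDeriv j u x i := fun i j =>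
    contDiff_euclidean.1 ((contDiff_fderiv hu).clm_apply contDiff_const) i
  exact contDiff_const.mul ((h i j).sub (h j i))

theorem fderiv_partialDeriv {u : Space n → Space n} (hu : ContDiff ℝ ∞ u) (x w : Space n)
    (i j : Fin n) : fderiv ℝ (fun y => partialDeriv j u y i) x w =
      fderiv ℝ (fderiv ℝ u) x w (EuclideanSpace.single j 1) i := by
  have h1 : DifferentiableAt ℝ (fderiv ℝ u) x := (contDiff_fderiv hu).differentiable (by simp) x
  have h2 : HasFDerivAt (fun y => fderiv ℝ u y (EuclideanSpace.single j 1))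
      ((fderiv ℝ (fderiv ℝ u) x).flip (EuclideanSpace.single j 1)) x := by
    simpa using h1.hasFDerivAt.clm_apply (hasFDerivAt_const (EuclideanSpace.single j (1 : ℝ)) x)
  have h3 := fderiv_component h2.differentiableAt i w
  rw [h2.fderiv] at h3
  exact h3

theorem fderiv_curl {u : Space n → Space n} (hu : ContDiff ℝ ∞ u) (x w : Space n) (i j : Fin n) :
    fderiv ℝ (curl u) x w i j =
      (1 / 2) * (fderiv ℝ (fderiv ℝ u) x w (EuclideanSpace.single j 1) i -
        fderiv ℝ (fderiv ℝ u) x w (EuclideanSpace.single i 1) j) := by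
  have h := ((contDiff_curl hu).differentiable (by simp) x).hasFDerivAt
  have h1 := (hasFDerivAt_pi'.1 ((hasFDerivAt_pi'.1 h) i)) j
  have h2 : ∀ i j : Fin n, DifferentiableAt ℝ (fun y => partialDeriv j u y i) x := fun i j =>
    (contDiff_euclidean.1 ((contDiff_fderiv hu).clm_apply contDiff_const) i).differentiable
      (by simp) x
  have h3 : HasFDerivAt (fun y => curl u y i j) ((1 / 2 : ℝ) •
      (fderiv ℝ (fun y => partialDeriv j u y i) x - fderiv ℝ (fun y => partialDeriv i u y j) x))
      x := ((h2 i j).hasFDerivAt.sub (h2 j i).hasFDerivAt).const_mul (1 / 2)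
  have h4 := congrArg (fun L => L w) (h1.unique h3)
  simp only [smul_apply, sub_apply,
    fderiv_partialDeriv hu, smul_eq_mul] at h4
  exact h4

theorem fderiv_fderiv_symm {F : Type*} [NormedAddCommGroup F] [NormedSpace ℝ F]
    {f : Space n → F} (hf : ContDiff ℝ ∞ f) (x v w : Space n) :
    fderiv ℝ (fderiv ℝ f) x v w = fderiv ℝ (fderiv ℝ f) x w v :=
  (hf.contDiffAt.isSymmSndFDerivAt (by simpa using WithTop.coe_le_coe.2 (le_top : (2 : ℕ∞) ≤ ⊤))) v w

/-! ### The vorticity equation -/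

theorem velocityRate_apply (u : Space n → Space n) (ρ p : Space n → ℝ) (x : Space n) (i : Fin n) :
    velocityRate u ρ p x i =
      -(fderiv ℝ u x (u x) i) - (ρ x)⁻¹ * fderiv ℝ p x (EuclideanSpace.single i 1) := by
  simp [velocityRate, gradient_apply]

theorem contDiff_velocityRate {u : Space n → Space n} {ρ p : Space n → ℝ} (hu : ContDiff ℝ ∞ u)
    (hρ : ContDiff ℝ ∞ ρ) (hρ0 : ∀ x, ρ x ≠ 0) (hp : ContDiff ℝ ∞ p) :
    ContDiff ℝ ∞ (velocityRate u ρ p) := by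
  rw [contDiff_euclidean]
  intro i
  simp only [velocityRate_apply]
  exact (contDiff_euclidean.1 ((contDiff_fderiv hu).clm_apply hu) i).neg.sub
    ((hρ.inv hρ0).mul ((contDiff_fderiv hp).clm_apply contDiff_const))

theorem velocityGradient_velocityRate {u : Space n → Space n} {ρ p : Space n → ℝ}
    (hu : ContDiff ℝ ∞ u) (hρ : ContDiff ℝ ∞ ρ) (hρ0 : ∀ x, ρ x ≠ 0) (hp : ContDiff ℝ ∞ p)
    (x : Space n) (i j : Fin n) :
    velocityGradient (velocityRate u ρ p) x i j =
      -(fderiv ℝ (fderiv ℝ u) x (EuclideanSpace.single j 1) (u x) i) -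
        ∑ a, velocityGradient u x i a * velocityGradient u x a j +
        (ρ x ^ 2)⁻¹ * (fderiv ℝ ρ x (EuclideanSpace.single j 1) *
          fderiv ℝ p x (EuclideanSpace.single i 1)) -
        (ρ x)⁻¹ * fderiv ℝ (fderiv ℝ p) x (EuclideanSpace.single j 1)
          (EuclideanSpace.single i 1) := by
  have hv := (contDiff_velocityRate hu hρ hρ0 hp).differentiable (by simp) x
  rw [velocityGradient, partialDeriv, ← fderiv_component hv]
  simp only [velocityRate_apply]
  have dU : HasFDerivAt (fun y => fderiv ℝ u y (u y)) _ x :=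
    ((contDiff_fderiv hu).differentiable (by simp) x).hasFDerivAt.clm_apply
      (hu.differentiable (by simp) x).hasFDerivAt
  have dUi := (EuclideanSpace.proj i : Space n →L[ℝ] ℝ).hasFDerivAt.comp x dU
  have dρ := (hasFDerivAt_inv (hρ0 x)).comp x (hρ.differentiable (by simp) x).hasFDerivAt
  have dp : HasFDerivAt (fun y => fderiv ℝ p y (EuclideanSpace.single i 1)) _ x :=
    ((contDiff_fderiv hp).differentiable (by simp) x).hasFDerivAt.clm_apply
      (hasFDerivAt_const (EuclideanSpace.single i (1 : ℝ)) x)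
  have h := (dUi.neg.sub (dρ.mul dp)).fderiv
  have h' := congrArg (fun L => L (EuclideanSpace.single j 1)) h
  refine h'.trans ?_
  have hA : fderiv ℝ u x (fderiv ℝ u x (EuclideanSpace.single j 1)) i =
      ∑ a, velocityGradient u x i a * velocityGradient u x a j := by
    rw [apply_eq_sum_single (fderiv ℝ u x) (fderiv ℝ u x (EuclideanSpace.single j 1))]
    simp only [WithLp.ofLp_sum, Finset.sum_apply, PiLp.smul_apply, smul_eq_mul]
    exact Finset.sum_congr rfl fun a _ => mul_comm _ _
  rw [← hA]
  simp
  ring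

/-- The baroclinic term `(∂_j ρ ∂_i p - ∂_i ρ ∂_j p) / (2 ρ²)` for given values of `ρ` and of the
gradients of `ρ` and `p`. -/
noncomputable def baroclinic (ρ : ℝ) (dρ dp : Fin n → ℝ) (i j : Fin n) : ℝ :=
  (1 / 2) * (ρ ^ 2)⁻¹ * (dρ j * dp i - dρ i * dp j)

/-- The vorticity equation `𝒟_t ω + u·∇ω = -(Aᵀ ω + ω A) + b`. -/
theorem curl_velocityRate_add {u : Space n → Space n} {ρ p : Space n → ℝ}
    (hu : ContDiff ℝ ∞ u) (hρ : ContDiff ℝ ∞ ρ) (hρ0 : ∀ x, ρ x ≠ 0) (hp : ContDiff ℝ ∞ p)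
    (x : Space n) :
    curl (velocityRate u ρ p) x + fderiv ℝ (curl u) x (u x) =
      -lieAction (velocityGradient u x) (curl u x) +
        baroclinic (ρ x) (fun i => fderiv ℝ ρ x (EuclideanSpace.single i 1))
          (fun i => fderiv ℝ p x (EuclideanSpace.single i 1)) := by
  funext i j
  -- For ω the antisymmetric part of A, Aᵀω + ωA is the antisymmetric part of A², the term produced
  -- by differentiating u·∇u. The second derivatives of `u` cancel against u·∇ω, and the Hessian of
  -- `p` drops out by symmetry.
  have e1 : lieAction (velocityGradient u x) (curl u x) i j =
      (1 / 2) * (∑ a, velocityGradient u x i a * velocityGradient u x a j -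
        ∑ a, velocityGradient u x j a * velocityGradient u x a i) := by
    simp only [lieAction, curl_eq_skewPart, skewPart]
    rw [← Finset.sum_add_distrib, ← Finset.sum_sub_distrib, Finset.mul_sum]
    exact Finset.sum_congr rfl fun a _ => by ring
  simp only [Pi.add_apply, Pi.neg_apply, e1, fderiv_curl hu, baroclinic]
  rw [curl_eq_skewPart, skewPart, velocityGradient_velocityRate hu hρ hρ0 hp,
    velocityGradient_velocityRate hu hρ hρ0 hp,
    fderiv_fderiv_symm hu x (EuclideanSpace.single j 1) (u x),
    fderiv_fderiv_symm hu x (EuclideanSpace.single i 1) (u x),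
    fderiv_fderiv_symm hp x (EuclideanSpace.single j 1) (EuclideanSpace.single i 1)]
  ring

/-! ### The local balance of a density -/

theorem divergence_smul {g : Space n → ℝ} {u : Space n → Space n} {x : Space n}
    (hg : DifferentiableAt ℝ g x) (hu : DifferentiableAt ℝ u x) :
    divergence (fun y => g y • u y) x = fderiv ℝ g x (u x) + g x * divergence u x := by
  simp only [divergence, partialDeriv]
  rw [apply_eq_sum_single (fderiv ℝ g x) (u x), Finset.mul_sum, ← Finset.sum_add_distrib]
  refine Finset.sum_congr rfl fun i _ => ?_
  rw [(hg.hasFDerivAt.fun_smul hu.hasFDerivAt).fderiv]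
  simp
  ring

theorem curl_add_smul {u v : Space n → Space n} {x : Space n} (hu : DifferentiableAt ℝ u x)
    (hv : DifferentiableAt ℝ v x) (τ : ℝ) :
    curl (fun y => u y + τ • v y) x = curl u x + τ • curl v x := by
  funext i j
  simp only [curl, partialDeriv, (hu.hasFDerivAt.fun_add (hv.hasFDerivAt.fun_const_smul τ)).fderiv,
    Pi.add_apply, Pi.smul_apply, add_apply, smul_apply,
    PiLp.add_apply, PiLp.smul_apply, smul_eq_mul]
  ring

variable {G V : Type*} [NormedAddCommGroup G] [NormedSpace ℝ G] [NormedAddCommGroup V]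
  [NormedSpace ℝ V]

/-- The time derivative and the convective derivative both pass through the same differential of
`T`, so they combine into the material derivatives of the state and of the vorticity; the flux adds
`T` times div u. -/
theorem timeDeriv_add_divergence {rate : (Space n → Space n × G) → Space n → Space n × G}
    {vort : (Space n → Space n) → Space n → V} {F : (Fin n → Fin n → ℝ) → V}
    (hF : Differentiable ℝ F) (hvort : ∀ u x, vort u x = F (curl u x))
    {T : Space n × G → V → ℝ} {q : Space n → Space n × G} (hq : ContDiff ℝ ∞ q) {x : Space n}
    (hv : DifferentiableAt ℝ (fun y => (rate q y).1) x)
    (hT : DifferentiableAt ℝ (fun z : (Space n × G) × V => T z.1 z.2)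
      (q x, F (curl (fun y => (q y).1) x))) :
    timeDeriv rate vort T q x + divergence (fun y => densityAt vort T q y • (q y).1) x =
      fderiv ℝ (fun z : (Space n × G) × V => T z.1 z.2) (q x, F (curl (fun y => (q y).1) x))
        (rate q x + fderiv ℝ q x (q x).1, fderiv ℝ F (curl (fun y => (q y).1) x)
          (curl (fun y => (rate q y).1) x + fderiv ℝ (curl fun y => (q y).1) x (q x).1)) +
      T (q x) (F (curl (fun y => (q y).1) x)) * divergence (fun y => (q y).1) x := by
  have hu : ContDiff ℝ ∞ fun y => (q y).1 := contDiff_fst.comp hq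
  have hud := hu.differentiable (by simp) x
  set L := fderiv ℝ (fun z : (Space n × G) × V => T z.1 z.2) (q x, F (curl (fun y => (q y).1) x))
  have h1 : timeDeriv rate vort T q x =
      L (rate q x, fderiv ℝ F (curl (fun y => (q y).1) x) (curl (fun y => (rate q y).1) x)) := by
    have e : ∀ τ : ℝ, densityAt vort T (fun y => q y + τ • rate q y) x =
        T (q x + τ • rate q x)
          (F (curl (fun y => (q y).1) x + τ • curl (fun y => (rate q y).1) x)) := by
      intro τ
      simp only [densityAt, hvort, Prod.fst_add, Prod.smul_fst]
      rw [curl_add_smul hud hv]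
    simp only [timeDeriv, e]
    have c1 : HasDerivAt (fun τ : ℝ => q x + τ • rate q x) (rate q x) 0 := by
      simpa using ((hasDerivAt_id' (0 : ℝ)).smul_const (rate q x)).const_add (q x)
    have c2 : HasDerivAt (fun τ : ℝ => curl (fun y => (q y).1) x +
        τ • curl (fun y => (rate q y).1) x) (curl (fun y => (rate q y).1) x) 0 := by
      simpa using ((hasDerivAt_id' (0 : ℝ)).smul_const
        (curl (fun y => (rate q y).1) x)).const_add (curl (fun y => (q y).1) x)
    have c3 : HasFDerivAt F (fderiv ℝ F (curl (fun y => (q y).1) x))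
        (curl (fun y => (q y).1) x + (0 : ℝ) • curl (fun y => (rate q y).1) x) := by
      simpa using (hF _).hasFDerivAt
    have c4 := c1.prodMk (c3.comp_hasDerivAt (0 : ℝ) c2)
    have c5 : HasFDerivAt (fun z : (Space n × G) × V => T z.1 z.2) L
        (q x + (0 : ℝ) • rate q x, (F ∘ fun τ : ℝ => curl (fun y => (q y).1) x +
        τ • curl (fun y => (rate q y).1) x) 0) := by
      simpa using hT.hasFDerivAt
    exact (c5.comp_hasDerivAt (0 : ℝ) c4).deriv
  have h2 : HasFDerivAt (fun y => densityAt vort T q y)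
      (L.comp ((fderiv ℝ q x).prod ((fderiv ℝ F (curl (fun y => (q y).1) x)).comp
        (fderiv ℝ (curl fun y => (q y).1) x)))) x := by
    have c1 := (hq.differentiable (by simp) x).hasFDerivAt.prodMk
      ((hF (curl (fun y => (q y).1) x)).hasFDerivAt.comp x
        ((contDiff_curl hu).differentiable (by simp) x).hasFDerivAt)
    have c2 := HasFDerivAt.comp (g := fun z : (Space n × G) × V => T z.1 z.2)
      (f := fun y => (q y, F (curl (fun y => (q y).1) y))) x hT.hasFDerivAt c1
    simp only [densityAt, hvort]
    exact c2
  rw [divergence_smul h2.differentiableAt hud, h1, h2.fderiv, ← add_assoc]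
  congr 1
  · rw [ContinuousLinearMap.comp_apply, ← map_add]
    simp
  · rw [densityAt, hvort]

end CompressibleFlow

namespace CompressibleFlow

variable {n : ℕ} {V : Type*} [NormedAddCommGroup V] [NormedSpace ℝ V]

/-! ### The balance for solutions of the Euler equations -/

theorem velocityRate_add (u : Space n → Space n) (ρ p : Space n → ℝ) (x : Space n) :
    velocityRate u ρ p x + fderiv ℝ u x (u x) = -((ρ x)⁻¹ • gradient p x) := by
  simp only [velocityRate]
  abel

theorem densityRate_add {u : Space n → Space n} {ρ : Space n → ℝ} {x : Space n}
    (hu : DifferentiableAt ℝ u x) (hρ : DifferentiableAt ℝ ρ x) :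
    densityRate u ρ x + fderiv ℝ ρ x (u x) = -(ρ x * divergence u x) := by
  rw [densityRate, divergence_smul hρ hu]
  ring

/-- Once the material derivatives are inserted, no second derivative of a field remains. The balance
is a relation between first-order data at `x`. -/
theorem balance_isentropic {P : ℝ → ℝ} (hP : ContDiffOn ℝ ∞ P (Set.Ioi 0))
    {vort : (Space n → Space n) → Space n → V} {F : (Fin n → Fin n → ℝ) → V}
    (hF : Differentiable ℝ F) (hvort : ∀ u x, vort u x = F (curl u x))
    {T : Space n × ℝ → V → ℝ} {u : Space n → Space n} {ρ : Space n → ℝ}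
    (hu : ContDiff ℝ ∞ u) (hρ : ContDiff ℝ ∞ ρ) (hρ0 : ∀ x, 0 < ρ x) {x : Space n}
    (hT : DifferentiableAt ℝ (fun z : (Space n × ℝ) × V => T z.1 z.2)
      ((u x, ρ x), F (curl u x))) :
    timeDeriv (isentropicRate P) vort T (fun y => (u y, ρ y)) x +
        divergence (fun y => densityAt vort T (fun y => (u y, ρ y)) y • u y) x =
      fderiv ℝ (fun z : (Space n × ℝ) × V => T z.1 z.2) ((u x, ρ x), F (curl u x))
        ((-((ρ x)⁻¹ • gradient (fun y => P (ρ y)) x), -(ρ x * divergence u x)),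
          fderiv ℝ F (curl u x) (-lieAction (velocityGradient u x) (curl u x) +
            baroclinic (ρ x) (fun i => fderiv ℝ ρ x (EuclideanSpace.single i 1))
              (fun i => fderiv ℝ (fun y => P (ρ y)) x (EuclideanSpace.single i 1)))) +
      T (u x, ρ x) (F (curl u x)) * divergence u x := by
  have hp : ContDiff ℝ ∞ fun y => P (ρ y) := hP.comp_contDiff hρ hρ0
  have hud := hu.differentiable (by simp) x
  have hρd := hρ.differentiable (by simp) x
  have hv := contDiff_velocityRate hu hρ (fun x => (hρ0 x).ne') hp
  have h := timeDeriv_add_divergence (rate := isentropicRate P) (x := x) hF hvort (hu.prodMk hρ)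
    (hv.differentiable (by simp) x) hT
  rw [← curl_velocityRate_add hu hρ (fun x => (hρ0 x).ne') hp, ← velocityRate_add,
    ← densityRate_add hud hρd]
  refine h.trans ?_
  rw [hud.fderiv_prodMk hρd]
  rfl

theorem balance_euler {P : ℝ → ℝ → ℝ}
    (hP : ContDiffOn ℝ ∞ (fun z : ℝ × ℝ => P z.1 z.2) {z | 0 < z.1})
    {vort : (Space n → Space n) → Space n → V} {F : (Fin n → Fin n → ℝ) → V}
    (hF : Differentiable ℝ F) (hvort : ∀ u x, vort u x = F (curl u x))
    {T : Space n × ℝ × ℝ → V → ℝ} {u : Space n → Space n} {ρ S : Space n → ℝ}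
    (hu : ContDiff ℝ ∞ u) (hρ : ContDiff ℝ ∞ ρ) (hS : ContDiff ℝ ∞ S) (hρ0 : ∀ x, 0 < ρ x)
    {x : Space n} (hT : DifferentiableAt ℝ (fun z : (Space n × ℝ × ℝ) × V => T z.1 z.2)
      ((u x, ρ x, S x), F (curl u x))) :
    timeDeriv (eulerRate P) vort T (fun y => (u y, ρ y, S y)) x +
        divergence (fun y => densityAt vort T (fun y => (u y, ρ y, S y)) y • u y) x =
      fderiv ℝ (fun z : (Space n × ℝ × ℝ) × V => T z.1 z.2) ((u x, ρ x, S x), F (curl u x))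
        ((-((ρ x)⁻¹ • gradient (fun y => P (ρ y) (S y)) x), -(ρ x * divergence u x), 0),
          fderiv ℝ F (curl u x) (-lieAction (velocityGradient u x) (curl u x) +
            baroclinic (ρ x) (fun i => fderiv ℝ ρ x (EuclideanSpace.single i 1))
              (fun i => fderiv ℝ (fun y => P (ρ y) (S y)) x (EuclideanSpace.single i 1)))) +
      T (u x, ρ x, S x) (F (curl u x)) * divergence u x := by
  have hp : ContDiff ℝ ∞ fun y => P (ρ y) (S y) := hP.comp_contDiff (hρ.prodMk hS) hρ0
  have hud := hu.differentiable (by simp) x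
  have hρd := hρ.differentiable (by simp) x
  have hSd := hS.differentiable (by simp) x
  have hv := contDiff_velocityRate hu hρ (fun x => (hρ0 x).ne') hp
  have h := timeDeriv_add_divergence (rate := eulerRate P) (x := x) hF hvort
    (hu.prodMk (hρ.prodMk hS)) (hv.differentiable (by simp) x) hT
  have e : (0 : ℝ) = entropyRate u S x + fderiv ℝ S x (u x) := (neg_add_cancel _).symm
  rw [← curl_velocityRate_add hu hρ (fun x => (hρ0 x).ne') hp, ← velocityRate_add,
    ← densityRate_add hud hρd, e]
  refine h.trans ?_
  rw [hud.fderiv_prodMk (hρd.prodMk hSd), hρd.fderiv_prodMk hSd]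
  rfl

/-! ### Fields with prescribed first-order data at the origin -/

/-- The linear functional with coefficients `g`. -/
noncomputable def linearForm (g : Fin n → ℝ) : Space n →L[ℝ] ℝ :=
  ∑ j, g j • (EuclideanSpace.proj j : Space n →L[ℝ] ℝ)

@[simp] theorem linearForm_single (g : Fin n → ℝ) (i : Fin n) :
    linearForm g (EuclideanSpace.single i 1) = g i := by
  simp [linearForm]

/-- The linear vector field with gradient `A`. -/
noncomputable def linearField (A : Fin n → Fin n → ℝ) : Space n →L[ℝ] Space n :=
  ∑ i, (linearForm (A i)).smulRight (EuclideanSpace.single i (1 : ℝ))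

@[simp] theorem linearField_apply (A : Fin n → Fin n → ℝ) (y : Space n) (i : Fin n) :
    linearField A y i = linearForm (A i) y := by
  simp [linearField, Pi.single_apply]

theorem contDiff_affineField (u₀ : Space n) (A : Fin n → Fin n → ℝ) :
    ContDiff ℝ ∞ fun y => u₀ + linearField A y := contDiff_const.add (linearField A).contDiff

theorem velocityGradient_affineField (u₀ : Space n) (A : Fin n → Fin n → ℝ) (x : Space n) :
    velocityGradient (fun y => u₀ + linearField A y) x = A := by
  funext i j
  rw [velocityGradient, partialDeriv, ((linearField A).hasFDerivAt.const_add u₀).fderiv]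
  simp

/-- The exponential keeps the density positive on the whole space while allowing any logarithmic
gradient `g` at the origin; an affine density would not. -/
theorem contDiff_expDensity (ρ₀ : ℝ) (g : Fin n → ℝ) :
    ContDiff ℝ ∞ fun y => ρ₀ * Real.exp (linearForm g y) :=
  contDiff_const.mul (Real.contDiff_exp.comp (linearForm g).contDiff)

theorem hasFDerivAt_expDensity (ρ₀ : ℝ) (g : Fin n → ℝ) :
    HasFDerivAt (fun y => ρ₀ * Real.exp (linearForm g y)) (ρ₀ • linearForm g) 0 := by
  have h := ((linearForm g).hasFDerivAt (x := 0)).exp.const_mul ρ₀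
  simpa using h

theorem gradient_eq_toLp {p : Space n → ℝ} {L : Space n →L[ℝ] ℝ} {x : Space n}
    (h : HasFDerivAt p L x) :
    gradient p x = WithLp.toLp 2 fun i => L (EuclideanSpace.single i 1) := by
  ext i
  rw [gradient_apply, h.fderiv]

theorem isOpen_physical : IsOpen (physical n) :=
  isOpen_lt continuous_const (continuous_fst.comp continuous_snd)

theorem isOpen_isentropicPhysical : IsOpen (isentropicPhysical n) :=
  isOpen_lt continuous_const continuous_snd

theorem IsConservedOnMovingDomains.differentiableAt {G : Type*} [NormedAddCommGroup G]
    [NormedSpace ℝ G] {Ω : Set (Space n × G)} (hΩ : IsOpen Ω)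
    {rate : (Space n → Space n × G) → Space n → Space n × G}
    {vort : (Space n → Space n) → Space n → V} {T : Space n × G → V → ℝ}
    (hT : IsConservedOnMovingDomains Ω rate vort T) {s : Space n × G} (hs : s ∈ Ω) (w : V) :
    DifferentiableAt ℝ (fun z : (Space n × G) × V => T z.1 z.2) (s, w) :=
  (hT.1.contDiffAt ((hΩ.preimage continuous_fst).mem_nhds hs)).differentiableAt (by simp)

/-- The balance at the origin for affine velocity and exponential density. As `u₀`, `ρ₀`, `A`, `g`
are arbitrary, it becomes a family of pointwise linear conditions on the differential of `T`. -/
theorem IsConservedOnMovingDomains.isentropic_identity {P : ℝ → ℝ}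
    (hP : ContDiffOn ℝ ∞ P (Set.Ioi 0))
    {vort : (Space n → Space n) → Space n → V} {F : (Fin n → Fin n → ℝ) → V}
    (hF : Differentiable ℝ F) (hvort : ∀ u x, vort u x = F (curl u x))
    {T : Space n × ℝ → V → ℝ}
    (hT : IsConservedOnMovingDomains (isentropicPhysical n) (isentropicRate P) vort T)
    (u₀ : Space n) {ρ₀ : ℝ} (hρ₀ : 0 < ρ₀) (A : Fin n → Fin n → ℝ) (g : Fin n → ℝ) :
    fderiv ℝ (fun z : (Space n × ℝ) × V => T z.1 z.2) ((u₀, ρ₀), F (skewPart A))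
        ((-(WithLp.toLp 2 fun i => deriv P ρ₀ * g i), -(ρ₀ * ∑ i, A i i)),
          fderiv ℝ F (skewPart A) (-lieAction A (skewPart A) +
            baroclinic ρ₀ (fun i => ρ₀ * g i) (fun i => deriv P ρ₀ * (ρ₀ * g i)))) +
      T (u₀, ρ₀) (F (skewPart A)) * ∑ i, A i i = 0 := by
  have hu := contDiff_affineField u₀ A
  have hρ := contDiff_expDensity ρ₀ g
  have hpos : ∀ y, 0 < ρ₀ * Real.exp (linearForm g y) := fun y => mul_pos hρ₀ (Real.exp_pos _)
  have u0 : u₀ + linearField A 0 = u₀ := by simp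
  have r0 : ρ₀ * Real.exp (linearForm g 0) = ρ₀ := by simp
  have hc : curl (fun y => u₀ + linearField A y) 0 = skewPart A := by
    rw [curl_eq_skewPart, velocityGradient_affineField]
  have hp : HasFDerivAt (fun y => P (ρ₀ * Real.exp (linearForm g y)))
      (deriv P ρ₀ • ρ₀ • linearForm g) 0 := by
    have hd : HasDerivAt P (deriv P ρ₀) (ρ₀ * Real.exp (linearForm g 0)) := by
      rw [r0]
      exact ((hP.contDiffAt (Ioi_mem_nhds hρ₀)).differentiableAt (by simp)).hasDerivAt
    exact hd.comp_hasFDerivAt 0 (hasFDerivAt_expDensity ρ₀ g)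
  have h := balance_isentropic (x := 0) hP hF hvort (T := T) hu hρ hpos
    (hT.differentiableAt isOpen_isentropicPhysical (hpos 0) _)
  have h0 := hT.2 (fun y => (u₀ + linearField A y, ρ₀ * Real.exp (linearForm g y)))
    ⟨hu.prodMk hρ, hpos⟩ 0
  rw [h, gradient_eq_toLp hp, hp.fderiv, (hasFDerivAt_expDensity ρ₀ g).fderiv] at h0
  simp only [divergence_eq_sum, velocityGradient_affineField, hc, u0, r0] at h0
  simp only [smul_apply, linearForm_single, smul_eq_mul] at h0
  convert h0 using 6
  ext i
  simp
  field_simp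

theorem IsConservedOnMovingDomains.euler_identity {P : ℝ → ℝ → ℝ}
    (hP : ContDiffOn ℝ ∞ (fun z : ℝ × ℝ => P z.1 z.2) {z | 0 < z.1})
    {vort : (Space n → Space n) → Space n → V} {F : (Fin n → Fin n → ℝ) → V}
    (hF : Differentiable ℝ F) (hvort : ∀ u x, vort u x = F (curl u x))
    {T : Space n × ℝ × ℝ → V → ℝ}
    (hT : IsConservedOnMovingDomains (physical n) (eulerRate P) vort T)
    (u₀ : Space n) {ρ₀ : ℝ} (hρ₀ : 0 < ρ₀) (S₀ : ℝ) (A : Fin n → Fin n → ℝ) (g s : Fin n → ℝ) :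
    fderiv ℝ (fun z : (Space n × ℝ × ℝ) × V => T z.1 z.2) ((u₀, ρ₀, S₀), F (skewPart A))
        ((-(ρ₀⁻¹ • WithLp.toLp 2 fun i =>
            fderiv ℝ (fun z : ℝ × ℝ => P z.1 z.2) (ρ₀, S₀) (ρ₀ * g i, s i)),
          -(ρ₀ * ∑ i, A i i), 0),
          fderiv ℝ F (skewPart A) (-lieAction A (skewPart A) +
            baroclinic ρ₀ (fun i => ρ₀ * g i) (fun i =>
              fderiv ℝ (fun z : ℝ × ℝ => P z.1 z.2) (ρ₀, S₀) (ρ₀ * g i, s i)))) +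
      T (u₀, ρ₀, S₀) (F (skewPart A)) * ∑ i, A i i = 0 := by
  have hu := contDiff_affineField u₀ A
  have hρ := contDiff_expDensity ρ₀ g
  have hS : ContDiff ℝ ∞ fun y => S₀ + linearForm s y := contDiff_const.add (linearForm s).contDiff
  have hpos : ∀ y, 0 < ρ₀ * Real.exp (linearForm g y) := fun y => mul_pos hρ₀ (Real.exp_pos _)
  have u0 : u₀ + linearField A 0 = u₀ := by simp
  have r0 : ρ₀ * Real.exp (linearForm g 0) = ρ₀ := by simp
  have s0 : S₀ + linearForm s 0 = S₀ := by simp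
  have hc : curl (fun y => u₀ + linearField A y) 0 = skewPart A := by
    rw [curl_eq_skewPart, velocityGradient_affineField]
  have hp : HasFDerivAt (fun y => P (ρ₀ * Real.exp (linearForm g y)) (S₀ + linearForm s y))
      ((fderiv ℝ (fun z : ℝ × ℝ => P z.1 z.2) (ρ₀, S₀)).comp
        ((ρ₀ • linearForm g).prod (linearForm s))) 0 := by
    have hd : HasFDerivAt (fun z : ℝ × ℝ => P z.1 z.2)
        (fderiv ℝ (fun z : ℝ × ℝ => P z.1 z.2) (ρ₀, S₀))
        ((fun y => (ρ₀ * Real.exp (linearForm g y), S₀ + linearForm s y)) 0) := by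
      simp only [r0, s0]
      exact ((hP.contDiffAt ((isOpen_lt continuous_const continuous_fst).mem_nhds
        hρ₀)).differentiableAt (by simp)).hasFDerivAt
    exact hd.comp 0 ((hasFDerivAt_expDensity ρ₀ g).prodMk
      ((linearForm s).hasFDerivAt.const_add S₀))
  have h := balance_euler (x := 0) hP hF hvort (T := T) hu hρ hS hpos
    (hT.differentiableAt isOpen_physical (hpos 0) _)
  have h0 := hT.2 (fun y => (u₀ + linearField A y, ρ₀ * Real.exp (linearForm g y),
    S₀ + linearForm s y)) ⟨hu.prodMk (hρ.prodMk hS), hpos⟩ 0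
  rw [h, gradient_eq_toLp hp, hp.fderiv, (hasFDerivAt_expDensity ρ₀ g).fderiv] at h0
  simp only [divergence_eq_sum, velocityGradient_affineField, hc, u0, r0, s0] at h0
  simpa only [ContinuousLinearMap.comp_apply, ContinuousLinearMap.prod_apply,
    smul_apply, linearForm_single, smul_eq_mul] using h0

end CompressibleFlow

namespace CompressibleFlow

variable {n : ℕ} {G V : Type*} [NormedAddCommGroup G] [NormedSpace ℝ G] [NormedAddCommGroup V]
  [NormedSpace ℝ V]

/-! ### Densities independent of the vorticity -/

theorem IsVorticityIndependent.isKinematicUpToDivergence {Ω : Set (Space n × G)}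
    {vort : (Space n → Space n) → Space n → V} {T : Space n × G → V → ℝ}
    (hT : ContDiffOn ℝ ∞ (fun z : (Space n × G) × V => T z.1 z.2) {z | z.1 ∈ Ω})
    (h : IsVorticityIndependent Ω T) : IsKinematicUpToDivergence Ω vort T := by
  -- The kinematic density is `T` at zero vorticity; the potential is zero and of jet order `k = 0`.
  refine ⟨fun z => T z.2.2 0, ?_, 0, fun _ => 0, contDiffOn_const, fun t q hq x => ?_⟩
  · exact hT.comp (contDiff_snd.snd.prodMk contDiff_const).contDiffOn fun z hz => hz
  · change T (q x) (vort (fun y => (q y).1) x) - T (q x) 0 = _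
    rw [h _ (hq.2 x) _ 0, sub_self]
    simp [divergence, partialDeriv]

theorem IsConservedOnMovingDomains.contDiff_vorticity {Ω : Set (Space n × G)}
    {rate : (Space n → Space n × G) → Space n → Space n × G}
    {vort : (Space n → Space n) → Space n → V} {T : Space n × G → V → ℝ}
    (hT : IsConservedOnMovingDomains Ω rate vort T) {s : Space n × G} (hs : s ∈ Ω) :
    ContDiff ℝ ∞ (T s) :=
  hT.1.comp_contDiff (contDiff_const.prodMk contDiff_id) fun _ => hs

theorem hasFDerivAt_vorticity {T : Space n × G → V → ℝ} {s : Space n × G} {w : V}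
    (h : DifferentiableAt ℝ (fun z : (Space n × G) × V => T z.1 z.2) (s, w)) :
    HasFDerivAt (T s) ((fderiv ℝ (fun z : (Space n × G) × V => T z.1 z.2) (s, w)).comp
      (ContinuousLinearMap.inr ℝ (Space n × G) V)) w :=
  h.hasFDerivAt.comp w (hasFDerivAt_prodMk_right s w)

theorem eq_of_fderiv_vorticity_eq_zero {T : Space n × G → V → ℝ} {s : Space n × G}
    (h : ∀ w, DifferentiableAt ℝ (fun z : (Space n × G) × V => T z.1 z.2) (s, w))
    (h0 : ∀ w v, fderiv ℝ (fun z : (Space n × G) × V => T z.1 z.2) (s, w) (0, v) = 0) (w w' : V) :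
    T s w = T s w' := by
  refine is_const_of_fderiv_eq_zero (𝕜 := ℝ)
    (fun w => (hasFDerivAt_vorticity (h w)).differentiableAt) (fun w => ?_) w w'
  rw [(hasFDerivAt_vorticity (h w)).fderiv]
  ext v
  simpa using h0 w v

/-! ### Odd dimensions -/

/-- `exists_vectorForm_skewPart_eq` misses the hyperplane `v 0 = 0`; density and continuity make up
for it. -/
theorem dense_coord_ne_zero [NeZero n] : Dense {v : Space n | v 0 ≠ 0} := by
  intro v
  by_cases hv : v 0 = 0
  · have h : Filter.Tendsto (fun t : ℝ => v + t • EuclideanSpace.single (0 : Fin n) (1 : ℝ))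
        (nhdsWithin 0 {0}ᶜ) (nhds v) := by
      have : Continuous fun t : ℝ => v + t • EuclideanSpace.single (0 : Fin n) (1 : ℝ) := by
        fun_prop
      have := this.tendsto 0
      simp only [zero_smul, add_zero] at this
      exact this.mono_left nhdsWithin_le_nhds
    refine mem_closure_of_tendsto h ?_
    filter_upwards [self_mem_nhdsWithin] with t ht
    simpa [hv] using ht
  · exact subset_closure hv

/-- A symmetric traceless matrix maps a given nonzero vector to any given vector. -/
theorem exists_symm_traceless {ι : Type*} [Fintype ι] [DecidableEq ι] (hι : 1 < Fintype.card ι)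
    {v : ι → ℝ} (hv : v ≠ 0) (w : ι → ℝ) :
    ∃ E : ι → ι → ℝ, (∀ i j, E i j = E j i) ∧ ∑ i, E i i = 0 ∧ ∀ i, ∑ j, E i j * v j = w i := by
  set N := ∑ i, v i * v i with hN
  set s := ∑ i, w i * v i with hs
  set d : ℝ := Fintype.card ι - 1 with hd
  have hN0 : N ≠ 0 := by
    intro h
    refine hv (funext fun i => ?_)
    have := (Finset.sum_eq_zero_iff_of_nonneg fun i _ => mul_self_nonneg (v i)).1 h i
      (Finset.mem_univ i)
    exact mul_self_eq_zero.1 this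
  have hd0 : d ≠ 0 := by
    have : (1 : ℝ) < Fintype.card ι := by exact_mod_cast hι
    exact (sub_pos.2 this).ne'
  -- The first two terms form a symmetric matrix sending v to w, of trace s/N. The last one is a
  -- multiple of the projection orthogonal to v: it kills v, and its coefficient cancels the trace,
  -- using that the orthogonal complement has dimension `d ≠ 0`.
  refine ⟨fun i j => (w i * v j + v i * w j) / N - s / N ^ 2 * (v i * v j) -
    s / (N * d) * ((if i = j then 1 else 0) - v i * v j / N), fun i j => ?_, ?_, fun i => ?_⟩
  · simp only [eq_comm (a := i)]
    ring
  · have : ∀ i, (w i * v i + v i * w i) / N - s / N ^ 2 * (v i * v i) -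
        s / (N * d) * ((if i = i then 1 else 0) - v i * v i / N) =
        (2 / N) * (w i * v i) + (- (s / N ^ 2) + s / (N * d) / N) * (v i * v i) -
          s / (N * d) := by
      intro i
      rw [if_pos rfl]
      ring
    rw [Finset.sum_congr rfl fun i _ => this i]
    simp only [Finset.sum_sub_distrib, Finset.sum_add_distrib, ← Finset.mul_sum, ← hN, ← hs,
      Finset.sum_const, Finset.card_univ, nsmul_eq_mul]
    have : (Fintype.card ι : ℝ) = d + 1 := by rw [hd]; ring
    rw [this]
    field_simp
    ring
  · have : ∀ j, ((w i * v j + v i * w j) / N - s / N ^ 2 * (v i * v j) -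
        s / (N * d) * ((if i = j then 1 else 0) - v i * v j / N)) * v j =
        (w i / N - s / N ^ 2 * v i + s / (N * d) * (v i / N)) * (v j * v j) +
        v i / N * (w j * v j) - s / (N * d) * (if i = j then v j else 0) := by
      intro j
      split_ifs <;> ring
    simp only [this, Finset.sum_sub_distrib, Finset.sum_add_distrib, ← Finset.mul_sum, ← hN, ← hs,
      Finset.sum_ite_eq, Finset.mem_univ, if_true]
    field_simp
    ring

/-- Replacing `A` by `A + E` with `E` symmetric and traceless keeps the curl but changes the
stretching by `E ϖ`, an arbitrary vector when ϖ ≠ 0. Subtracting the two instances of the hypothesis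
shows that the derivative of `T` in ϖ vanishes, first where ϖ⁰ ≠ 0 and then everywhere by
continuity. -/
theorem isVorticityIndependent_of_vector {m : ℕ} (hm : 1 ≤ m) {Ω : Set (Space (2 * m + 1) × G)}
    (hΩ : IsOpen Ω)
    {rate : (Space (2 * m + 1) → Space (2 * m + 1) × G) → Space (2 * m + 1) →
      Space (2 * m + 1) × G}
    {T : Space (2 * m + 1) × G → Space (2 * m + 1) → ℝ}
    (hT : IsConservedOnMovingDomains Ω rate (vorticityVector m) T)
    (h : ∀ s ∈ Ω, ∀ A : Fin (2 * m + 1) → Fin (2 * m + 1) → ℝ, ∑ i, A i i = 0 →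
      fderiv ℝ (fun z : (Space (2 * m + 1) × G) × Space (2 * m + 1) => T z.1 z.2)
        (s, vectorForm m (skewPart A))
        (0, fderiv ℝ (vectorForm m) (skewPart A) (lieAction A (skewPart A))) = 0) :
    IsVorticityIndependent Ω T := by
  intro s hs
  have hd := fun w => hT.differentiableAt hΩ hs w
  have hsm := hT.contDiff_vorticity hs
  have key : ∀ v : Space (2 * m + 1), v 0 ≠ 0 → fderiv ℝ (T s) v = 0 := by
    intro v hv
    rw [(hasFDerivAt_vorticity (hd v)).fderiv]
    ext w
    obtain ⟨A, hA0, hA⟩ := exists_vectorForm_skewPart_eq m hm v hv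
    obtain ⟨E, hEs, hE0, hE⟩ := exists_symm_traceless (ι := Fin (2 * m + 1)) (by simp; omega)
      (v := v.ofLp) (fun h => hv (congrFun h 0)) w.ofLp
    have h1 := h s hs A hA0
    have h2 := h s hs (A + E) (by simp [Finset.sum_add_distrib, hA0, hE0])
    rw [skewPart_add_symm _ _ hEs] at h2
    rw [hA] at h1 h2
    have h3 : fderiv ℝ (vectorForm m) (skewPart A) (lieAction A (skewPart A)) -
        fderiv ℝ (vectorForm m) (skewPart A) (lieAction (A + E) (skewPart A)) = w := by
      ext c
      rw [PiLp.sub_apply, fderiv_vectorForm_lieAction, fderiv_vectorForm_lieAction, hA, ← hE c]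
      simp only [Pi.add_apply, Finset.sum_add_distrib, hA0, hE0, add_mul]
      ring
    have h4 := sub_eq_zero_of_eq (h1.trans h2.symm)
    rw [← map_sub, Prod.mk_sub_mk, sub_zero, h3] at h4
    simpa using h4
  have key' : fderiv ℝ (T s) = fun _ => 0 :=
    Continuous.ext_on dense_coord_ne_zero (hsm.continuous_fderiv (by simp)) continuous_const key
  exact fun w w' => is_const_of_fderiv_eq_zero (hsm.differentiable (by simp))
    (fun v => congrFun key' v) w w'

theorem isVorticityIndependent_isentropic_odd {P : ℝ → ℝ} (hP : IsIsentropicEOS P) {m : ℕ}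
    (hm : 1 ≤ m) {T : Space (2 * m + 1) × ℝ → Space (2 * m + 1) → ℝ}
    (hT : IsConservedOnMovingDomains (isentropicPhysical (2 * m + 1)) (isentropicRate P)
      (vorticityVector m) T) : IsVorticityIndependent (isentropicPhysical (2 * m + 1)) T := by
  refine isVorticityIndependent_of_vector hm isOpen_isentropicPhysical hT ?_
  rintro ⟨u, ρ⟩ hρ A hA
  -- Uniform density, `g = 0`, removes the pressure force and the baroclinic term.
  have h := hT.isentropic_identity hP.1 ((contDiff_vectorForm m).differentiable (by simp))
    (vorticityVector_eq m) u hρ A 0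
  have hb : baroclinic ρ (fun i => ρ * (0 : Fin (2 * m + 1) → ℝ) i)
      (fun i => deriv P ρ * (ρ * (0 : Fin (2 * m + 1) → ℝ) i)) = 0 := by
    funext i j
    simp [baroclinic]
  have hg : (WithLp.toLp 2 fun i => deriv P ρ * (0 : Fin (2 * m + 1) → ℝ) i :
      Space (2 * m + 1)) = 0 := by
    ext i
    simp
  rw [hb, hg, hA, mul_zero, mul_zero, neg_zero, neg_zero, add_zero, add_zero, map_neg] at h
  rw [← neg_eq_zero, ← map_neg, Prod.neg_mk, neg_zero]
  exact h

theorem isVorticityIndependent_euler_odd {P : ℝ → ℝ → ℝ} (hP : IsNonIsentropicEOS P) {m : ℕ}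
    (hm : 1 ≤ m) {T : Space (2 * m + 1) × ℝ × ℝ → Space (2 * m + 1) → ℝ}
    (hT : IsConservedOnMovingDomains (physical (2 * m + 1)) (eulerRate P)
      (vorticityVector m) T) : IsVorticityIndependent (physical (2 * m + 1)) T := by
  refine isVorticityIndependent_of_vector hm isOpen_physical hT ?_
  rintro ⟨u, ρ, S⟩ hρ A hA
  have h := hT.euler_identity hP.1 ((contDiff_vectorForm m).differentiable (by simp))
    (vorticityVector_eq m) u hρ S A 0 0
  simp only [Pi.zero_apply, mul_zero, Prod.mk_zero_zero, map_zero] at h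
  have hb : baroclinic ρ (fun _ => 0) (fun _ : Fin (2 * m + 1) => 0) = 0 := by
    funext i j
    simp [baroclinic]
  have hg : (WithLp.toLp 2 fun _ => 0 : Space (2 * m + 1)) = 0 := by
    ext i
    simp
  rw [hb, hg, hA, mul_zero, mul_zero, neg_zero, add_zero, add_zero, map_neg, smul_zero,
    neg_zero] at h
  rw [← neg_eq_zero, ← map_neg, Prod.neg_mk, neg_zero]
  exact h

/-! ### Even dimensions -/

/-- Euler's theorem on homogeneous functions of degree one. -/
theorem homogeneous_of_euler {h : ℝ × ℝ → ℝ} (hd : ∀ r > 0, ∀ w, DifferentiableAt ℝ h (r, w))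
    (he : ∀ r > 0, ∀ w, fderiv ℝ h (r, w) (r, w) = h (r, w)) {r : ℝ} (hr : 0 < r) (w : ℝ)
    {c : ℝ} (hc : 0 < c) : h (c * r, c * w) = c * h (r, w) := by
  -- Euler's relation says exactly that h(tr, tw)/t has zero derivative on t > 0.
  have hder : ∀ t > 0, HasDerivAt (fun t : ℝ => h (t * r, t * w) / t) 0 t := by
    intro t ht
    have h1 : HasDerivAt (fun t : ℝ => (t * r, t * w)) (r, w) t := by
      simpa using ((hasDerivAt_id' t).mul_const r).prodMk ((hasDerivAt_id' t).mul_const w)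
    have h2 := (hd (t * r) (mul_pos ht hr) (t * w)).hasFDerivAt.comp_hasDerivAt t h1
    have h3 := h2.div (hasDerivAt_id' t) ht.ne'
    have h4 := he (t * r) (mul_pos ht hr) (t * w)
    have h5 : ((t * r, t * w) : ℝ × ℝ) = t • (r, w) := by simp
    have h6 : t * fderiv ℝ h (t * r, t * w) (r, w) = h (t * r, t * w) := by
      rw [← h4, ← smul_eq_mul, ← map_smul]
      simp
    have h7 : (fderiv ℝ h (t * r, t * w) (r, w) * t - (h ∘ fun t => (t * r, t * w)) t * 1) /
        t ^ 2 = 0 := by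
      rw [mul_comm _ t, h6]
      simp
    rw [h7] at h3
    exact h3
  have h1 := (isOpen_Ioi (a := (0 : ℝ))).is_const_of_deriv_eq_zero isPreconnected_Ioi
    (fun t ht => (hder t ht).differentiableAt.differentiableWithinAt)
    (fun t ht => (hder t ht).deriv) hc
    (Set.mem_Ioi.2 one_pos)
  simp only [one_mul, div_one] at h1
  rw [div_eq_iff hc.ne'] at h1
  rw [h1, mul_comm]

theorem fderiv_scalarForm_neg_lieAction (m : ℕ) (A w b : Fin (2 * m) → Fin (2 * m) → ℝ) :
    fderiv ℝ (scalarForm m) w (-lieAction A w + b) =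
      -((∑ i, A i i) * scalarForm m w) + fderiv ℝ (scalarForm m) w b := by
  rw [map_add, map_neg, fderiv_scalarForm_lieAction]

theorem exists_trace_one_scalarForm_eq (m : ℕ) (hm : 1 ≤ m) (s : ℝ) :
    ∃ A : Fin (2 * m) → Fin (2 * m) → ℝ, ∑ i, A i i = 1 ∧ scalarForm m (skewPart A) = s := by
  obtain ⟨A, hA0, hA, -⟩ := exists_scalarForm_skewPart_eq m hm s
  -- A multiple of the identity is symmetric, so it does not affect the curl; the factor 1/(2m)
  -- gives it trace 1.
  refine ⟨A + fun i j => if i = j then (1 / (2 * m) : ℝ) else 0, ?_, ?_⟩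
  · have : (m : ℝ) ≠ 0 := by positivity
    simp only [Pi.add_apply, Finset.sum_add_distrib, hA0, if_true, Finset.sum_const,
      Finset.card_univ, Fintype.card_fin, nsmul_eq_mul]
    push_cast
    field_simp
    ring
  · rw [skewPart_add_symm _ _ fun i j => by simp only [eq_comm], hA]

/-- Uniform ρ and S with tr A = 1 give ρ T_ρ + ϖ T_ϖ = T, hence homogeneity in (ρ, ϖ). Where ∂P/∂S ≠
0, crossed gradients of ρ and S give T_ϖ = 0. The equation of state guarantees such points only for
a dense set of entropies, each at some density: homogeneity carries the conclusion to all densities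
and continuity to all entropies. -/
theorem isVorticityIndependent_euler_even {P : ℝ → ℝ → ℝ} (hP : IsNonIsentropicEOS P) {m : ℕ}
    (hm : 1 ≤ m) {T : Space (2 * m) × ℝ × ℝ → ℝ → ℝ}
    (hT : IsConservedOnMovingDomains (physical (2 * m)) (eulerRate P)
      (vorticityScalar m) T) : IsVorticityIndependent (physical (2 * m)) T := by
  have hd : ∀ (u : Space (2 * m)) (ρ S w : ℝ), 0 < ρ → DifferentiableAt ℝ
      (fun z : (Space (2 * m) × ℝ × ℝ) × ℝ => T z.1 z.2) ((u, ρ, S), w) :=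
    fun u ρ S w hρ => hT.differentiableAt isOpen_physical hρ w
  have hid := fun u ρ hρ S A g s => hT.euler_identity (ρ₀ := ρ) hP.1
    ((contDiff_scalarForm m).differentiable (by simp)) (vorticityScalar_eq m) u hρ S A g s
  simp only [fderiv_scalarForm_neg_lieAction] at hid
  have hom : ∀ (u : Space (2 * m)) (ρ S w : ℝ), 0 < ρ → ∀ c > 0,
      T (u, c * ρ, S) (c * w) = c * T (u, ρ, S) w := by
    intro u ρ S w hρ c hc
    have hemb : ∀ r w : ℝ, 0 < r → HasFDerivAt (fun p : ℝ × ℝ => T (u, p.1, S) p.2) _ (r, w) :=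
      fun r w hr => HasFDerivAt.comp
        (g := fun z : (Space (2 * m) × ℝ × ℝ) × ℝ => T z.1 z.2)
        (f := fun p : ℝ × ℝ => ((u, p.1, S), p.2)) (r, w) (hd u r S w hr).hasFDerivAt
        (HasFDerivAt.prodMk
        (HasFDerivAt.prodMk (hasFDerivAt_const u (r, w))
          (HasFDerivAt.prodMk hasFDerivAt_fst (hasFDerivAt_const S (r, w)))) hasFDerivAt_snd)
    refine homogeneous_of_euler (h := fun p => T (u, p.1, S) p.2)
      (fun r hr w => (hemb r w hr).differentiableAt) (fun r hr w => ?_) hρ w hc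
    rw [(hemb r w hr).fderiv]
    obtain ⟨A, hA1, hA⟩ := exists_trace_one_scalarForm_eq m hm w
    have h := hid u r hr S A 0 0
    simp only [Pi.zero_apply, mul_zero, Prod.mk_zero_zero, map_zero, hA, hA1] at h
    have hb : baroclinic r (fun _ => 0) (fun _ : Fin (2 * m) => 0) = 0 := by
      funext i j
      simp [baroclinic]
    have hg : (WithLp.toLp 2 fun _ => 0 : Space (2 * m)) = 0 := by
      ext i
      simp
    rw [hb, hg, map_zero, mul_one, mul_one, one_mul, add_zero, smul_zero, neg_zero] at h
    have h2 : (((0 : Space (2 * m)), -r, (0 : ℝ)), -w) =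
        -(((0 : Space (2 * m)), r, (0 : ℝ)), w) := by simp
    rw [h2, map_neg, neg_add_eq_zero] at h
    simpa using h
  have hS : ∀ (u : Space (2 * m)) (ρ S : ℝ), 0 < ρ → deriv (fun s => P ρ s) S ≠ 0 →
      ∀ w w', T (u, ρ, S) w = T (u, ρ, S) w' := by
    intro u ρ S hρ hPS
    refine eq_of_fderiv_vorticity_eq_zero (fun w => hd u ρ S w hρ) fun w v => ?_
    obtain ⟨A, hA0, hA, hE⟩ := exists_scalarForm_skewPart_eq m hm w
    set L := fderiv ℝ (fun z : (Space (2 * m) × ℝ × ℝ) × ℝ => T z.1 z.2) ((u, ρ, S), w)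
    set D := fderiv ℝ (fun z : ℝ × ℝ => P z.1 z.2) (ρ, S) with hD
    have hDS : D (0, 1) ≠ 0 := by
      have h1 : HasFDerivAt (fun z : ℝ × ℝ => P z.1 z.2) D (ρ, S) :=
        ((hP.1.contDiffAt ((isOpen_lt continuous_const continuous_fst).mem_nhds
          hρ)).differentiableAt (by simp)).hasFDerivAt
      have h2 : HasDerivAt (fun s => P ρ s) (D (0, 1)) S :=
        h1.comp_hasDerivAt S ((hasDerivAt_const S ρ).prodMk (hasDerivAt_id' S))
      rwa [← h2.deriv]
    set g : Fin (2 * m) → ℝ := fun i => if i.1 = 0 then 1 else 0 with hg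
    set s : Fin (2 * m) → ℝ := fun i => if i.1 = 1 then 1 else 0 with hs
    have hDl : ∀ a b : ℝ, D (a, b) = a * D (1, 0) + b * D (0, 1) := by
      intro a b
      rw [← smul_eq_mul, ← smul_eq_mul, ← map_smul, ← map_smul, ← map_add]
      simp
    -- The baroclinic term is quadratic in the pair of gradients, so it is the same for `t = 1` and
    -- `t = -1`; the ∂P/∂ρ contribution cancels by antisymmetry.
    have hbar : ∀ t : ℝ, t * t = 1 → baroclinic ρ (fun i => ρ * (t • g) i)
        (fun i => D (ρ * (t • g) i, (t • s) i)) =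
        (-(ρ⁻¹ * D (0, 1))) • skewPart (matrixUnit (2 * m)) := by
      intro t ht
      funext i j
      have hm1 : ∀ i j, matrixUnit (2 * m) i j = g i * s j := by
        intro i j
        simp only [matrixUnit, hg, hs, ite_and]
        split_ifs <;> simp
      simp only [baroclinic, skewPart, hm1, hDl (ρ * _), Pi.smul_apply, smul_eq_mul]
      field_simp
      linear_combination (D (0, 1) * (g j * s i - g i * s j)) * ht
    have h1 := hid u ρ hρ S A ((1 : ℝ) • g) ((1 : ℝ) • s)
    have h2 := hid u ρ hρ S A ((-1 : ℝ) • g) ((-1 : ℝ) • s)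
    rw [hbar _ (by norm_num), hA0, hA, zero_mul, neg_zero, mul_zero, neg_zero, zero_add, mul_zero,
      add_zero] at h1 h2
    -- Adding the identities for opposite gradients cancels the pressure acceleration, which is odd,
    -- and doubles the baroclinic term. What is left is a derivative purely in the vorticity
    -- direction.
    have h3 : L (0, 2 * fderiv ℝ (scalarForm m) (skewPart A)
        ((-(ρ⁻¹ * D (0, 1))) • skewPart (matrixUnit (2 * m)))) = 0 := by
      have h4 := congrArg₂ (· + ·) h1 h2
      simp only [← map_add] at h4
      rw [add_zero] at h4
      refine Eq.trans ?_ h4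
      congr 1
      refine Prod.ext (Prod.ext ?_ ?_) ?_
      · ext i
        have : D (-(ρ * g i), -(s i)) = - D (ρ * g i, s i) := by
          rw [← map_neg]; simp
        simp [hD.symm, this]
      · simp [Prod.ext_iff]
      · simp only [Prod.snd_add, two_mul]
    set μ := 2 * fderiv ℝ (scalarForm m) (skewPart A)
        ((-(ρ⁻¹ * D (0, 1))) • skewPart (matrixUnit (2 * m))) with hμ
    have hμ0 : μ ≠ 0 := by
      rw [hμ, map_smul, smul_eq_mul]
      exact mul_ne_zero two_ne_zero (mul_ne_zero
        (neg_ne_zero.2 (mul_ne_zero (inv_ne_zero hρ.ne') hDS)) hE)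
    have h5 : ((0 : Space (2 * m) × ℝ × ℝ), v) = (v / μ) • ((0 : Space (2 * m) × ℝ × ℝ), μ) := by
      simp [hμ0]
    rw [h5, map_smul, h3, smul_zero]
  rintro ⟨u, ρ, S⟩ hρ w w'
  have hρ : 0 < ρ := hρ
  have hdense : Dense {S : ℝ | ∃ ρ > 0, deriv (fun s => P ρ s) S ≠ 0} := by
    rw [dense_iff_exists_between]
    intro a b hab
    obtain ⟨S, hS, h⟩ := hP.2 a b hab
    exact ⟨S, h, hS.1, hS.2⟩
  have hcont : ∀ w, Continuous fun S => T (u, ρ, S) w := fun w =>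
    (hT.1.comp_contDiff (contDiff_const.prodMk (contDiff_const.prodMk contDiff_id) |>.prodMk
      contDiff_const) fun S => hρ).continuous
  refine congrFun (Continuous.ext_on hdense (hcont w) (hcont w') ?_) S
  rintro S ⟨r, hr, hPS⟩
  -- Homogeneity transfers the question from density `ρ` to the density `r` at which ∂P/∂S ≠ 0.
  have h1 : ∀ w, T (u, ρ, S) w = (ρ / r) * T (u, r, S) ((r / ρ) * w) := by
    intro w
    rw [← hom u r S _ hr (ρ / r) (div_pos hρ hr)]
    congr 1
    · rw [div_mul_cancel₀ _ hr.ne']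
    · field_simp
  change T (u, ρ, S) w = T (u, ρ, S) w'
  rw [h1, h1, hS u r S hr hPS]

/-- Euler's relation again gives homogeneity in (ρ, ϖ). At one density with P' ≠ 0 the pressure
acceleration is arbitrary, so `T` does not depend on `u` there, and homogeneity extends this to
every density. Then T = ρ f(ϖ/ρ), with `f` the restriction of `T` to ρ = 1, u = 0. -/
theorem exists_isEnstrophyDensity {P : ℝ → ℝ} (hP : IsIsentropicEOS P) {m : ℕ}
    (hm : 1 ≤ m) {T : Space (2 * m) × ℝ → ℝ → ℝ}
    (hT : IsConservedOnMovingDomains (isentropicPhysical (2 * m)) (isentropicRate P)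
      (vorticityScalar m) T) : ∃ f : ℝ → ℝ, ContDiff ℝ ∞ f ∧ IsEnstrophyDensity f T := by
  have hd : ∀ (u : Space (2 * m)) (ρ w : ℝ), 0 < ρ → DifferentiableAt ℝ
      (fun z : (Space (2 * m) × ℝ) × ℝ => T z.1 z.2) ((u, ρ), w) :=
    fun u ρ w hρ => hT.differentiableAt isOpen_isentropicPhysical hρ w
  -- For p = P(ρ) the gradients of pressure and density are parallel.
  have hb : ∀ ρ (g : Fin (2 * m) → ℝ), baroclinic ρ (fun i => ρ * g i)
      (fun i => deriv P ρ * (ρ * g i)) = 0 := by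
    intro ρ g
    funext i j
    simp only [baroclinic, Pi.zero_apply]
    ring
  have hid := fun u ρ hρ A g => hT.isentropic_identity (ρ₀ := ρ) hP.1
    ((contDiff_scalarForm m).differentiable (by simp)) (vorticityScalar_eq m) u hρ A g
  simp only [fderiv_scalarForm_neg_lieAction] at hid
  simp only [hb, map_zero, add_zero] at hid
  have hom : ∀ (u : Space (2 * m)) (ρ w : ℝ), 0 < ρ → ∀ c > 0,
      T (u, c * ρ) (c * w) = c * T (u, ρ) w := by
    intro u ρ w hρ c hc
    have hemb : ∀ r w : ℝ, 0 < r → HasFDerivAt (fun p : ℝ × ℝ => T (u, p.1) p.2) _ (r, w) :=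
      fun r w hr => HasFDerivAt.comp
        (g := fun z : (Space (2 * m) × ℝ) × ℝ => T z.1 z.2)
        (f := fun p : ℝ × ℝ => ((u, p.1), p.2)) (r, w) (hd u r w hr).hasFDerivAt
        (HasFDerivAt.prodMk
        (HasFDerivAt.prodMk (hasFDerivAt_const u (r, w)) hasFDerivAt_fst) hasFDerivAt_snd)
    refine homogeneous_of_euler (h := fun p => T (u, p.1) p.2)
      (fun r hr w => (hemb r w hr).differentiableAt) (fun r hr w => ?_) hρ w hc
    rw [(hemb r w hr).fderiv]
    obtain ⟨A, hA1, hA⟩ := exists_trace_one_scalarForm_eq m hm w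
    have h := hid u r hr A 0
    have hg : (WithLp.toLp 2 fun i => deriv P r * (0 : Fin (2 * m) → ℝ) i : Space (2 * m)) = 0 := by
      ext i
      simp
    rw [hg, hA, hA1, mul_one, mul_one, one_mul, neg_zero] at h
    have h2 : (((0 : Space (2 * m)), -r), -w) = -(((0 : Space (2 * m)), r), w) := by simp
    rw [h2, map_neg, neg_add_eq_zero] at h
    simpa using h
  obtain ⟨ρ₀, hρ₀, hPρ⟩ := hP.2
  have hu : ∀ u w, T (u, ρ₀) w = T (0, ρ₀) w := by
    intro u w
    have hemb : ∀ u, HasFDerivAt (fun u : Space (2 * m) => T (u, ρ₀) w) _ u := fun u =>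
      HasFDerivAt.comp
        (g := fun z : (Space (2 * m) × ℝ) × ℝ => T z.1 z.2)
        (f := fun u : Space (2 * m) => ((u, ρ₀), w)) u (hd u ρ₀ w hρ₀).hasFDerivAt
        (HasFDerivAt.prodMk
        (HasFDerivAt.prodMk (hasFDerivAt_id u) (hasFDerivAt_const ρ₀ u)) (hasFDerivAt_const w u))
    refine is_const_of_fderiv_eq_zero (𝕜 := ℝ) (fun u => (hemb u).differentiableAt)
      (fun u => ?_) u 0
    rw [(hemb u).fderiv]
    ext v
    obtain ⟨A, hA0, hA, -⟩ := exists_scalarForm_skewPart_eq m hm w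
    -- The density gradient is chosen so that the pressure acceleration equals `v`.
    have h := hid u ρ₀ hρ₀ A fun i => -((deriv P ρ₀)⁻¹ * v i)
    have hv : -(WithLp.toLp 2 fun i => deriv P ρ₀ * -((deriv P ρ₀)⁻¹ * v i) : Space (2 * m)) =
        v := by
      ext i
      simp [hPρ]
    rw [hv, hA0, hA, mul_zero, mul_zero, zero_mul, neg_zero, add_zero] at h
    simpa using h
  refine ⟨fun w => T (0, 1) w, hT.contDiff_vorticity (s := (0, 1))
    (show (0 : ℝ) < 1 from one_pos), ?_⟩
  intro u ρ w hρ
  have h1 : ∀ u, T (u, ρ) w = (ρ / ρ₀) * T (u, ρ₀) ((ρ₀ / ρ) * w) := by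
    intro u
    rw [← hom u ρ₀ _ hρ₀ (ρ / ρ₀) (div_pos hρ hρ₀)]
    congr 1
    · rw [div_mul_cancel₀ _ hρ₀.ne']
    · field_simp
  rw [h1, hu, ← h1, ← hom 0 1 _ one_pos ρ hρ]
  congr 1
  · rw [mul_one]
  · field_simp

theorem IsEnstrophyDensity.contDiffOn {f : ℝ → ℝ} (hf : ContDiff ℝ ∞ f) {T : Space n × ℝ → ℝ → ℝ}
    (hT : IsEnstrophyDensity f T) :
    ContDiffOn ℝ ∞ (fun z : (Space n × ℝ) × ℝ => T z.1 z.2) {z | z.1 ∈ isentropicPhysical n} := by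
  have h : ContDiffOn ℝ ∞ (fun z : (Space n × ℝ) × ℝ => z.1.2 * f (z.2 / z.1.2))
      {z | z.1 ∈ isentropicPhysical n} :=
    contDiff_fst.snd.contDiffOn.mul (hf.comp_contDiffOn (contDiff_snd.contDiffOn.div
      contDiff_fst.snd.contDiffOn fun z hz => (show 0 < z.1.2 from hz).ne'))
  exact h.congr fun z hz => hT z.1.1 z.1.2 z.2 hz

/-- Without a baroclinic term ϖ and ρ obey the same continuity equation, so ϖ/ρ is constant along
the flow and ρ times any function of it is conserved. -/
theorem IsEnstrophyDensity.isConservedOnMovingDomains {P : ℝ → ℝ} (hP : IsIsentropicEOS P) {m : ℕ}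
    {f : ℝ → ℝ} (hf : ContDiff ℝ ∞ f) {T : Space (2 * m) × ℝ → ℝ → ℝ}
    (hT : IsEnstrophyDensity f T) :
    IsConservedOnMovingDomains (isentropicPhysical (2 * m)) (isentropicRate P)
      (vorticityScalar m) T := by
  have hsm := hT.contDiffOn hf
  refine ⟨hsm, fun q hq x => ?_⟩
  have hu : ContDiff ℝ ∞ fun y => (q y).1 := contDiff_fst.comp hq.1
  have hρ : ContDiff ℝ ∞ fun y => (q y).2 := contDiff_snd.comp hq.1
  obtain ⟨F, hF⟩ : ∃ F, scalarForm m (curl (fun y => (q y).1) x) = F := ⟨_, rfl⟩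
  have hρx : 0 < (q x).2 := hq.2 x
  have hopen : {z : (Space (2 * m) × ℝ) × ℝ | z.1 ∈ isentropicPhysical (2 * m)} ∈
      nhds ((((q x).1, (q x).2), F) : (Space (2 * m) × ℝ) × ℝ) :=
    (isOpen_isentropicPhysical.preimage continuous_fst).mem_nhds hρx
  have h := balance_isentropic (x := x) hP.1 ((contDiff_scalarForm m).differentiable (by simp))
    (vorticityScalar_eq m) (T := T) hu hρ hq.2
    (by rw [hF]; exact (hsm.contDiffAt hopen).differentiableAt (by simp))
  refine h.trans ?_
  have hb : baroclinic (q x).2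
      (fun i => fderiv ℝ (fun y => (q y).2) x (EuclideanSpace.single i 1))
      (fun i => fderiv ℝ (fun y => P (q y).2) x (EuclideanSpace.single i 1)) = 0 := by
    have hp : HasFDerivAt (fun y => P (q y).2) _ x :=
      ((hP.1.contDiffAt (Ioi_mem_nhds hρx)).differentiableAt
        (by simp)).hasDerivAt.comp_hasFDerivAt x (hρ.differentiable (by simp) x).hasFDerivAt
    funext i j
    rw [hp.fderiv]
    simp only [baroclinic, smul_apply, smul_eq_mul, Pi.zero_apply]
    ring
  have h0 : HasFDerivAt (fun z : (Space (2 * m) × ℝ) × ℝ => z.2)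
      (ContinuousLinearMap.snd ℝ (Space (2 * m) × ℝ) ℝ) (((q x).1, (q x).2), F) :=
    hasFDerivAt_snd
  have h1 : HasFDerivAt (fun z : (Space (2 * m) × ℝ) × ℝ => z.1.2)
      ((ContinuousLinearMap.snd ℝ (Space (2 * m)) ℝ).comp
        (ContinuousLinearMap.fst ℝ (Space (2 * m) × ℝ) ℝ)) (((q x).1, (q x).2), F) :=
    hasFDerivAt_fst.snd
  have h2 := HasDerivAt.comp_hasFDerivAt (((q x).1, (q x).2), F) (hasDerivAt_inv hρx.ne') h1
  have h3 := HasDerivAt.comp_hasFDerivAt (((q x).1, (q x).2), F)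
    (hf.differentiable (by simp) (F * (q x).2⁻¹)).hasDerivAt (h0.mul h2)
  have hL := HasFDerivAt.congr_of_eventuallyEq (f₁ := fun z : (Space (2 * m) × ℝ) × ℝ => T z.1 z.2)
    (h1.mul h3) (by filter_upwards [hopen] with z hz using hT z.1.1 z.1.2 z.2 hz)
  rw [hb, fderiv_scalarForm_neg_lieAction, divergence_eq_sum, map_zero, hF, hL.fderiv,
    hT _ _ _ hρx]
  simp
  field_simp
  ring

end CompressibleFlow

namespace CompressibleFlow

/-! ### The vorticity scalar is a divergence -/

section

variable {n : ℕ} {κ : Type*} [Fintype κ] [DecidableEq κ] {l r : κ ↪ Fin n}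

/-- A vector potential of the full contraction of the velocity gradient `A`, with `U` the value
of the velocity. -/
noncomputable def pairPotential (l r : κ ↪ Fin n) (k₀ : κ) (U : Space n) (A : Fin n → Fin n → ℝ) :
    Space n :=
  WithLp.toLp 2 fun j => ∑ σ : Equiv.Perm (Fin n), (if σ (r k₀) = j then
    ((Equiv.Perm.sign σ : ℤ) : ℝ) else 0) *
      (U (σ (l k₀)) * ∏ k ∈ Finset.univ.erase k₀, A (σ (l k)) (σ (r k)))

theorem contDiff_pairPotential (l r : κ ↪ Fin n) (k₀ : κ) {E : Type*} [NormedAddCommGroup E]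
    [NormedSpace ℝ E] {U : E → Space n} (hU : ContDiff ℝ ∞ U) {A : E → Fin n → Fin n → ℝ}
    (hA : ∀ i j, ContDiff ℝ ∞ fun z => A z i j) :
    ContDiff ℝ ∞ fun z => pairPotential l r k₀ (U z) (A z) := by
  rw [contDiff_euclidean]
  intro j
  exact ContDiff.sum fun σ _ => contDiff_const.mul ((contDiff_euclidean.1 hU _).mul
    (contDiff_prod fun k _ => hA _ _))

theorem contDiff_velocityGradient {u : Space n → Space n} (hu : ContDiff ℝ ∞ u) (i j : Fin n) :
    ContDiff ℝ ∞ fun x => velocityGradient u x i j :=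
  contDiff_euclidean.1 ((contDiff_fderiv hu).clm_apply contDiff_const) i

/-- The indices in the slots `r k₀` and `r k` are both differentiation indices. Exchanging them
flips the sign of the permutation and preserves the symmetric `B`. -/
theorem sum_sign_secondDeriv_eq_zero {k₀ k : κ} (hk : k ≠ k₀) (hlr : ∀ a b, l a ≠ r b)
    (U : Fin n → ℝ) (A : Fin n → Fin n → ℝ) (B : Fin n → Fin n → Fin n → ℝ)
    (hB : ∀ i j a, B i j a = B j i a) :
    ∑ σ : Equiv.Perm (Fin n), ((Equiv.Perm.sign σ : ℤ) : ℝ) * (U (σ (l k₀)) *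
      ((∏ a ∈ (Finset.univ.erase k₀).erase k, A (σ (l a)) (σ (r a))) *
        B (σ (r k₀)) (σ (r k)) (σ (l k)))) = 0 := by
  refine eq_zero_of_neg_eq ?_
  rw [← Finset.sum_neg_distrib]
  refine Fintype.sum_equiv (Equiv.mulRight (Equiv.swap (r k₀) (r k))) _ _ fun σ => ?_
  have hl : ∀ a, Equiv.swap (r k₀) (r k) (l a) = l a := fun a =>
    Equiv.swap_apply_of_ne_of_ne (hlr _ _) (hlr _ _)
  have hr : ∏ a ∈ (Finset.univ.erase k₀).erase k,
      A (σ (l a)) (σ (Equiv.swap (r k₀) (r k) (r a))) =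
      ∏ a ∈ (Finset.univ.erase k₀).erase k, A (σ (l a)) (σ (r a)) := by
    refine Finset.prod_congr rfl fun a ha => ?_
    rw [Equiv.swap_apply_of_ne_of_ne]
    · exact r.injective.ne (Finset.ne_of_mem_erase (Finset.mem_of_mem_erase ha))
    · exact r.injective.ne (Finset.ne_of_mem_erase ha)
  simp only [Equiv.coe_mulRight, Equiv.Perm.sign_mul, Equiv.Perm.sign_swap (r.injective.ne hk.symm),
    Equiv.Perm.mul_apply, hl, hr, Equiv.swap_apply_left, Equiv.swap_apply_right,
    hB (σ (r k)) (σ (r k₀))]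
  push_cast
  ring

/-- The contraction is ∂ applied to `u` in the slot `k₀`, times the other factors. Moving this
derivative outside the product costs only second derivatives, which cancel by antisymmetry. -/
theorem divergence_pairPotential {u : Space n → Space n} (hu : ContDiff ℝ ∞ u)
    (hlr : ∀ a b, l a ≠ r b) (k₀ : κ) (x : Space n) :
    divergence (fun y => pairPotential l r k₀ (u y) (velocityGradient u y)) x =
      pairSum l r (fun _ => 1) fun _ => velocityGradient u x := by
  have hX : DifferentiableAt ℝ (fun y => pairPotential l r k₀ (u y) (velocityGradient u y)) x :=
    (contDiff_pairPotential l r k₀ hu (contDiff_velocityGradient hu)).differentiable (by simp) x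
  have hud : ∀ i, HasFDerivAt (fun y => u y i)
      ((EuclideanSpace.proj i : Space n →L[ℝ] ℝ).comp (fderiv ℝ u x)) x := fun i =>
    (EuclideanSpace.proj i : Space n →L[ℝ] ℝ).hasFDerivAt.comp x
      (hu.differentiable (by simp) x).hasFDerivAt
  have hAd : ∀ i j, HasFDerivAt (fun y => velocityGradient u y i j)
      (fderiv ℝ (fun y => velocityGradient u y i j) x) x := fun i j =>
    ((contDiff_velocityGradient hu i j).differentiable (by simp) x).hasFDerivAt
  have hφ := fun σ : Equiv.Perm (Fin n) => (hud (σ (l k₀))).mul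
    (HasFDerivAt.finsetProd (u := Finset.univ.erase k₀)
      (g := fun k y => velocityGradient u y (σ (l k)) (σ (r k))) (x := x)
      fun k _ => hAd (σ (l k)) (σ (r k)))
  have hXj : ∀ j, fderiv ℝ (fun y => pairPotential l r k₀ (u y) (velocityGradient u y) j) x = _ :=
    fun j => (HasFDerivAt.fun_sum (u := Finset.univ) fun σ _ =>
      (hφ σ).const_mul (if σ (r k₀) = j then ((Equiv.Perm.sign σ : ℤ) : ℝ) else 0)).fderiv
  have h0 : divergence (fun y => pairPotential l r k₀ (u y) (velocityGradient u y)) x =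
      ∑ j, fderiv ℝ (fun y => pairPotential l r k₀ (u y) (velocityGradient u y) j) x
        (EuclideanSpace.single j 1) := by
    refine Finset.sum_congr rfl fun j _ => ?_
    rw [fderiv_component hX]
    rfl
  rw [h0]
  simp only [hXj, sum_apply, smul_apply, add_apply, smul_eq_mul, ite_mul,
    zero_mul]
  rw [Finset.sum_comm]
  simp only [Finset.sum_ite_eq, Finset.mem_univ, if_true, ContinuousLinearMap.comp_apply,
    mul_add, Finset.sum_add_distrib]
  have h1 : ∑ σ : Equiv.Perm (Fin n), ((Equiv.Perm.sign σ : ℤ) : ℝ) * (u x (σ (l k₀)) *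
      ∑ k ∈ Finset.univ.erase k₀, (∏ a ∈ (Finset.univ.erase k₀).erase k,
        velocityGradient u x (σ (l a)) (σ (r a))) *
          fderiv ℝ (fun y => velocityGradient u y (σ (l k)) (σ (r k))) x
            (EuclideanSpace.single (σ (r k₀)) 1)) = 0 := by
    simp only [Finset.mul_sum]
    rw [Finset.sum_comm]
    refine Finset.sum_eq_zero fun k hk => ?_
    have hB := sum_sign_secondDeriv_eq_zero (Finset.ne_of_mem_erase hk) hlr (u x)
      (velocityGradient u x) (fun i j a => fderiv ℝ (fderiv ℝ u) x (EuclideanSpace.single i 1)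
        (EuclideanSpace.single j 1) a) fun i j a => by rw [fderiv_fderiv_symm hu]
    simpa only [velocityGradient, fderiv_partialDeriv hu] using hB
  rw [h1, zero_add]
  refine Finset.sum_congr rfl fun σ _ => ?_
  rw [one_mul, ← Finset.mul_prod_erase _ _ (Finset.mem_univ k₀), mul_comm (∏ k ∈ _, _)]
  rfl

end

/-- For f(s) = as + b the density is aϖ + bρ: the second term is kinematic and the first is a
divergence. -/
theorem IsEnstrophyDensity.isKinematicUpToDivergence_of_isAffine {m : ℕ} (hm : 1 ≤ m) {f : ℝ → ℝ}
    (hf : IsAffine f) {T : Space (2 * m) × ℝ → ℝ → ℝ} (hT : IsEnstrophyDensity f T) :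
    IsKinematicUpToDivergence (isentropicPhysical (2 * m)) (vorticityScalar m) T := by
  obtain ⟨a, b, hab⟩ := hf
  -- Jets of order `k = 1` suffice: the entry with index 0 is the first derivative of the state. The
  -- factor `a` is put on the velocity, in which the potential is linear.
  refine ⟨fun z => b * z.2.2.2, (contDiff_const.mul contDiff_snd.snd.snd).contDiffOn, 1,
    fun z => pairPotential (evenLeft m) (evenRight m) ⟨0, hm⟩ (a • z.2.2.1.1) fun i j =>
      (z.2.2.2 0 fun _ => EuclideanSpace.single j 1).1 i, ?_, fun t q hq x => ?_⟩
  · refine ContDiff.contDiffOn (contDiff_pairPotential _ _ _ ?_ fun i j => ?_)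
    · fun_prop
    have h1 : ContDiff ℝ ∞ fun z : ℝ × Space (2 * m) × (Space (2 * m) × ℝ) × ((j : Fin 1) →
        ContinuousMultilinearMap ℝ (fun _ : Fin (j + 1) => Space (2 * m)) (Space (2 * m) × ℝ)) =>
        z.2.2.2 0 := contDiff_pi.1 contDiff_snd.snd.snd 0
    have h2 := (ContinuousMultilinearMap.apply ℝ
      (fun _ : Fin ((0 : Fin 1) + 1) => Space (2 * m)) (Space (2 * m) × ℝ)
      (fun _ => EuclideanSpace.single j 1)).contDiff.comp h1
    exact contDiff_euclidean.1 (contDiff_fst.comp h2) i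
  · have hu : ContDiff ℝ ∞ fun y => (q y).1 := contDiff_fst.comp hq.1
    have hd := divergence_pairPotential (l := evenLeft m) (r := evenRight m) hu
      evenLeft_ne_evenRight ⟨0, hm⟩ x
    have hρ : 0 < (q x).2 := hq.2 x
    have hsm : ∀ U A, pairPotential (evenLeft m) (evenRight m) ⟨0, hm⟩ (a • U) A =
        a • pairPotential (evenLeft m) (evenRight m) ⟨0, hm⟩ U A := by
      intro U A
      ext j
      simp only [pairPotential, PiLp.smul_apply, smul_eq_mul, Finset.mul_sum]
      exact Finset.sum_congr rfl fun σ _ => by ring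
    have hX := (contDiff_pairPotential (evenLeft m) (evenRight m) ⟨0, hm⟩ hu
      (contDiff_velocityGradient hu)).differentiable (by simp) x
    have hgrad : ∀ y i j, (iteratedFDeriv ℝ 1 q y fun _ => EuclideanSpace.single j 1).1 i =
        velocityGradient (fun y => (q y).1) y i j := by
      intro y i j
      rw [iteratedFDeriv_one_apply, velocityGradient, partialDeriv,
        fderiv.fst (hq.1.differentiable (by simp) y)]
      rfl
    have hdiv : divergence (fun y => a • pairPotential (evenLeft m) (evenRight m) ⟨0, hm⟩ (q y).1
        (velocityGradient (fun y => (q y).1) y)) x =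
        a * scalarForm m (velocityGradient (fun y => (q y).1) x) := by
      rw [divergence_smul (g := fun _ => a) (differentiableAt_const a) hX, hd]
      simp [scalarForm]
    have hL : densityAt (vorticityScalar m) T q x - b * (q x).2 =
        a * scalarForm m (velocityGradient (fun y => (q y).1) x) := by
      rw [densityAt, vorticityScalar_eq, curl_eq_skewPart, scalarForm_skewPart]
      refine (congrArg (· - _) (hT (q x).1 (q x).2 _ hρ)).trans ?_
      simp only [hab]
      field_simp
      ring
    refine hL.trans (hdiv.symm.trans ?_)
    simp only [← hsm]
    congr 1
    funext y
    congr 1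
    funext i j
    exact (hgrad y i j).symm

end CompressibleFlow

namespace CompressibleFlow

open MeasureTheory

/-! ### A one-dimensional null Lagrangian is affine -/

section NullLagrangian

variable {E : Type*} [NormedAddCommGroup E] [NormedSpace ℝ E] [FiniteDimensional ℝ E]
  [MeasurableSpace E] [BorelSpace E] {μ : Measure E} [μ.IsAddHaarMeasure]

omit [FiniteDimensional ℝ E] [NormedSpace ℝ E] [μ.IsAddHaarMeasure] in
-- The derivative in `t` is continuous and vanishes off `K`, so on |t| ≤ 1 a constant supported on
-- `K` dominates it.
theorem hasDerivAt_integral_of_compact [IsFiniteMeasureOnCompacts μ] [T2Space E]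
    [SecondCountableTopology E] {F F' : ℝ → E → ℝ}
    (hF : ∀ t x, HasDerivAt (fun t => F t x) (F' t x) t) (hFc : ∀ t, Continuous (F t))
    (hF' : Continuous fun p : ℝ × E => F' p.1 p.2) (hF0 : Integrable (F 0) μ) {K : Set E}
    (hK : IsCompact K) (hsupp : ∀ t, ∀ x ∉ K, F' t x = 0) :
    HasDerivAt (fun t => ∫ x, F t x ∂μ) (∫ x, F' 0 x ∂μ) 0 := by
  obtain ⟨C, hC⟩ := ((isCompact_Icc (a := (-1 : ℝ)) (b := 1)).prod hK).exists_bound_of_continuousOn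
    hF'.continuousOn
  refine (hasDerivAt_integral_of_dominated_loc_of_deriv_le (s := Set.Icc (-1) 1)
    (bound := K.indicator fun _ => C) (Icc_mem_nhds (by norm_num) (by norm_num))
    (Filter.Eventually.of_forall fun t => (hFc t).aestronglyMeasurable) hF0
    (hF'.comp (Continuous.prodMk_right 0)).aestronglyMeasurable
    (Filter.Eventually.of_forall fun x t ht => ?_) ?_
    (Filter.Eventually.of_forall fun x t _ => hF t x)).2
  · by_cases hx : x ∈ K
    · rw [Set.indicator_of_mem hx]
      exact hC (t, x) ⟨ht, hx⟩
    · rw [Set.indicator_of_notMem hx, hsupp t x hx, norm_zero]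
  · rw [integrable_indicator_iff hK.measurableSet]
    exact integrableOn_const hK.measure_lt_top.ne

theorem integral_fderiv_apply_eq_zero {φ : E → ℝ} (hφ : ContDiff ℝ ∞ φ)
    (hc : HasCompactSupport φ) (e : E) : ∫ x, fderiv ℝ φ x e ∂μ = 0 := by
  have hd : Continuous fun x => fderiv ℝ φ x e :=
    ((contDiff_fderiv hφ).clm_apply contDiff_const).continuous
  have h := integral_mul_fderiv_eq_neg_fderiv_mul_of_integrable (μ := μ) (f := fun _ : E => (1 : ℝ))
    (g := φ) (v := e) (by simp) (by simpa using
      hd.integrable_of_hasCompactSupport (hc.fderiv_apply (𝕜 := ℝ) (v := e)))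
    (by simpa using hφ.continuous.integrable_of_hasCompactSupport hc)
    (fun x _ => differentiableAt_const _) (fun x _ => hφ.differentiable (by simp) x)
  simpa using h

omit [FiniteDimensional ℝ E] [MeasurableSpace E] [BorelSpace E] in
theorem fderiv_apply_eq_zero_of_notMem {φ : E → ℝ} {x : E} (hx : x ∉ tsupport φ) (e : E) :
    fderiv ℝ φ x e = 0 := by
  have h : φ =ᶠ[nhds x] fun _ => 0 := notMem_tsupport_iff_eventuallyEq.1 hx
  rw [h.fderiv_eq]
  simp

/-- The first variation of `∫ f (∂_e h) - g (x, h)`. -/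
theorem integral_first_variation {e : E} {f : ℝ → ℝ} (hf : ContDiff ℝ ∞ f) {g : E × ℝ → ℝ}
    (hg : ContDiff ℝ ∞ g) {h φ : E → ℝ} (hh : ContDiff ℝ ∞ h) (hφ : ContDiff ℝ ∞ φ)
    (hc : HasCompactSupport φ)
    (hnull : ∀ t : ℝ, ∫ x, ((f (fderiv ℝ (fun y => h y + t * φ y) x e) - g (x, h x + t * φ x)) -
      (f (fderiv ℝ h x e) - g (x, h x))) ∂μ = 0) :
    ∫ x, (deriv f (fderiv ℝ h x e) * fderiv ℝ φ x e - fderiv ℝ g (x, h x) (0, 1) * φ x) ∂μ = 0 := by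
  have hhd : Continuous fun x => fderiv ℝ h x e :=
    ((contDiff_fderiv hh).clm_apply contDiff_const).continuous
  have hφd : Continuous fun x => fderiv ℝ φ x e :=
    ((contDiff_fderiv hφ).clm_apply contDiff_const).continuous
  have hf' : Continuous (deriv f) := hf.continuous_deriv (by simp)
  have hg' : Continuous fun p => fderiv ℝ g p (0, 1) :=
    ((contDiff_fderiv hg).clm_apply contDiff_const).continuous
  have hlin : ∀ (t : ℝ) x, fderiv ℝ (fun y => h y + t * φ y) x e =
      fderiv ℝ h x e + t * fderiv ℝ φ x e := by
    intro t x
    rw [((hh.differentiable (by simp) x).hasFDerivAt.fun_add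
      ((hφ.differentiable (by simp) x).hasFDerivAt.const_mul t)).fderiv]
    simp
  simp only [hlin] at hnull
  -- The unperturbed Lagrangian is subtracted inside the integral because neither Lagrangian need be
  -- integrable by itself; the difference has compact support.
  have key := hasDerivAt_integral_of_compact (μ := μ)
    (F := fun t x => (f (fderiv ℝ h x e + t * fderiv ℝ φ x e) - g (x, h x + t * φ x)) -
      (f (fderiv ℝ h x e) - g (x, h x)))
    (F' := fun t x => deriv f (fderiv ℝ h x e + t * fderiv ℝ φ x e) * fderiv ℝ φ x e -
      fderiv ℝ g (x, h x + t * φ x) (0, 1) * φ x) (K := tsupport φ)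
    (fun t x => ?_) (fun t => ?_) ?_ ?_ hc (fun t x hx => ?_)
  · simp only [hnull] at key
    have := key.unique (hasDerivAt_const 0 0)
    simpa using this
  · have h1 : HasDerivAt (fun t : ℝ => fderiv ℝ h x e + t * fderiv ℝ φ x e) (fderiv ℝ φ x e) t := by
      simpa using ((hasDerivAt_id' t).mul_const (fderiv ℝ φ x e)).const_add (fderiv ℝ h x e)
    have h2 : HasDerivAt (fun t : ℝ => (x, h x + t * φ x)) (0, φ x) t := by
      simpa using (hasDerivAt_const t x).prodMk
        (((hasDerivAt_id' t).mul_const (φ x)).const_add (h x))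
    have h3 := ((hf.differentiable (by simp) _).hasDerivAt.comp t h1).sub
      ((hg.differentiable (by simp) _).hasFDerivAt.comp_hasDerivAt t h2)
    have h4 : fderiv ℝ g (x, h x + t * φ x) (0, φ x) =
        fderiv ℝ g (x, h x + t * φ x) (0, 1) * φ x := by
      have h5 : ((0 : E), φ x) = φ x • ((0 : E), (1 : ℝ)) := by simp
      rw [h5, map_smul, smul_eq_mul, mul_comm]
    rw [h4] at h3
    exact h3.sub_const _
  · have := hh.continuous
    have := hφ.continuous
    have := hf.continuous
    have := hg.continuous
    fun_prop
  · have := hh.continuous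
    have := hφ.continuous
    fun_prop
  · simp
  · simp [fderiv_apply_eq_zero_of_notMem hx, image_eq_zero_of_notMem_tsupport hx]

/-- The Euler-Lagrange equation of a null Lagrangian `f (∂_e h) - g (x, h)`. -/
theorem euler_lagrange_eq_zero {e : E} {f : ℝ → ℝ} (hf : ContDiff ℝ ∞ f) {g : E × ℝ → ℝ}
    (hg : ContDiff ℝ ∞ g) {h : E → ℝ} (hh : ContDiff ℝ ∞ h)
    (hnull : ∀ φ : E → ℝ, ContDiff ℝ ∞ φ → HasCompactSupport φ →
      ∫ x, ((f (fderiv ℝ (fun y => h y + φ y) x e) - g (x, h x + φ x)) -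
        (f (fderiv ℝ h x e) - g (x, h x))) ∂μ = 0) (x : E) :
    fderiv ℝ (fun y => deriv f (fderiv ℝ h y e)) x e + fderiv ℝ g (x, h x) (0, 1) = 0 := by
  have hp : ContDiff ℝ ∞ fun y => deriv f (fderiv ℝ h y e) :=
    (hf.iterate_deriv 1).comp ((contDiff_fderiv hh).clm_apply contDiff_const)
  have hpd : Continuous fun x => fderiv ℝ (fun y => deriv f (fderiv ℝ h y e)) x e :=
    ((contDiff_fderiv hp).clm_apply contDiff_const).continuous
  have hgd : Continuous fun x => fderiv ℝ g (x, h x) (0, 1) :=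
    ((contDiff_fderiv hg).clm_apply contDiff_const).continuous.comp
      (continuous_id.prodMk hh.continuous)
  have hc := hpd.add hgd
  -- Fundamental lemma of the calculus of variations; its hypothesis follows from the first
  -- variation after integration by parts.
  have hae := ae_eq_zero_of_integral_contDiff_smul_eq_zero (μ := μ) hc.locallyIntegrable
    fun φ hφ hcφ => ?_
  · exact congrFun (hc.ae_eq_iff_eq (μ := μ) continuous_const |>.1 hae) x
  · have hφd : Continuous fun x => fderiv ℝ φ x e :=
      ((contDiff_fderiv hφ).clm_apply contDiff_const).continuous
    have h1 := integral_first_variation (μ := μ) (e := e) hf hg hh hφ hcφ fun t =>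
      hnull (fun y => t * φ y) (contDiff_const.mul hφ) hcφ.mul_left
    have i1 : Integrable (fun x => deriv f (fderiv ℝ h x e) * fderiv ℝ φ x e) μ :=
      (hp.continuous.mul hφd).integrable_of_hasCompactSupport
        (hcφ.fderiv_apply (𝕜 := ℝ) (v := e)).mul_left
    have i2 : Integrable (fun x => fderiv ℝ g (x, h x) (0, 1) * φ x) μ :=
      (hgd.mul hφ.continuous).integrable_of_hasCompactSupport hcφ.mul_left
    have i3 : Integrable (fun x => fderiv ℝ (fun y => deriv f (fderiv ℝ h y e)) x e * φ x) μ :=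
      (hpd.mul hφ.continuous).integrable_of_hasCompactSupport hcφ.mul_left
    rw [integral_sub i1 i2, integral_mul_fderiv_eq_neg_fderiv_mul_of_integrable i3 i1
      ((hp.continuous.mul hφ.continuous).integrable_of_hasCompactSupport hcφ.mul_left)
      (fun x _ => hp.differentiable (by simp) x) (fun x _ => hφ.differentiable (by simp) x)] at h1
    have h2 : ∫ x, φ x • (fderiv ℝ (fun y => deriv f (fderiv ℝ h y e)) x e +
        fderiv ℝ g (x, h x) (0, 1)) ∂μ =
        ∫ x, fderiv ℝ (fun y => deriv f (fderiv ℝ h y e)) x e * φ x ∂μ +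
          ∫ x, fderiv ℝ g (x, h x) (0, 1) * φ x ∂μ := by
      rw [← integral_add i3 i2]
      congr 1
      funext x
      simp only [smul_eq_mul]
      ring
    refine h2.trans ?_
    linarith

/-- On h = a l + c l² the Euler-Lagrange equation at the origin reads 2c f''(a) + ∂g = 0. The value
of `h` there is 0 for every `c`, so the second term does not depend on `c`; comparing c = 0 with c =
1 gives f''(a) = 0. -/
theorem deriv_deriv_eq_zero_of_null {e : E} {l : E →L[ℝ] ℝ} (hl : l e = 1) {f : ℝ → ℝ}
    (hf : ContDiff ℝ ∞ f) {g : E × ℝ → ℝ} (hg : ContDiff ℝ ∞ g)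
    (hnull : ∀ h φ : E → ℝ, ContDiff ℝ ∞ h → ContDiff ℝ ∞ φ → HasCompactSupport φ →
      ∫ x, ((f (fderiv ℝ (fun y => h y + φ y) x e) - g (x, h x + φ x)) -
        (f (fderiv ℝ h x e) - g (x, h x))) ∂μ = 0) (a : ℝ) :
    deriv (deriv f) a = 0 := by
  have hsm : ∀ c : ℝ, ContDiff ℝ ∞ fun x => a * l x + c * (l x * l x) := fun c =>
    (contDiff_const.mul l.contDiff).add (contDiff_const.mul (l.contDiff.mul l.contDiff))
  have hd : ∀ (c : ℝ) x, fderiv ℝ (fun x => a * l x + c * (l x * l x)) x e = a + 2 * c * l x := by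
    intro c x
    rw [((l.hasFDerivAt.const_mul a).fun_add ((l.hasFDerivAt.fun_mul l.hasFDerivAt).const_mul c)).fderiv]
    simp [hl]
    ring
  have hEL : ∀ c : ℝ, deriv (deriv f) a * (2 * c) + fderiv ℝ g (0, 0) (0, 1) = 0 := by
    intro c
    have h := euler_lagrange_eq_zero (μ := μ) hf hg (hsm c) (fun φ => hnull _ φ (hsm c)) 0
    simp only [hd] at h
    have h1 : HasFDerivAt (fun y => a + 2 * c * l y) ((2 * c) • l) (0 : E) :=
      (l.hasFDerivAt.const_mul (2 * c)).const_add a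
    have h2 : HasDerivAt (deriv f) (deriv (deriv f) a) (a + 2 * c * l 0) := by
      simpa using ((hf.iterate_deriv 1).differentiable (by simp) a).hasDerivAt
    have h3 := (h2.comp_hasFDerivAt 0 h1).fderiv
    have h4 : fderiv ℝ (fun y => deriv f (a + 2 * c * l y)) 0 e = deriv (deriv f) a * (2 * c) := by
      refine (congrArg (fun L => L e) h3).trans ?_
      simp [hl]
    rw [h4] at h
    simpa using h
  have h0 := hEL 0
  have h1 := hEL 1
  linarith

end NullLagrangian

theorem isAffine_of_deriv_deriv_eq_zero {f : ℝ → ℝ} (hf : ContDiff ℝ ∞ f)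
    (h : ∀ a, deriv (deriv f) a = 0) : IsAffine f := by
  have hd : Differentiable ℝ f := hf.differentiable (by simp)
  have hd' : Differentiable ℝ (deriv f) := (hf.iterate_deriv 1).differentiable (by simp)
  have h1 : ∀ s, deriv f s = deriv f 0 := fun s => is_const_of_deriv_eq_zero hd' h s 0
  refine ⟨deriv f 0, f 0, fun s => ?_⟩
  have h2 : ∀ s, HasDerivAt (fun s => f s - deriv f 0 * s) 0 s := by
    intro s
    have := (hd s).hasDerivAt.fun_sub ((hasDerivAt_id' s).const_mul (deriv f 0))
    rw [h1 s] at this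
    simpa using this
  have h3 := is_const_of_deriv_eq_zero (fun s => (h2 s).differentiableAt)
    (fun s => (h2 s).deriv) s 0
  simp only [mul_zero, sub_zero] at h3
  linarith

end CompressibleFlow

namespace CompressibleFlow

open MeasureTheory

/-! ### Kinematic enstrophy densities are affine -/

theorem integral_divergence_eq_zero {n : ℕ} {Z : Space n → Space n} (hZ : ContDiff ℝ ∞ Z)
    (hc : HasCompactSupport Z) : ∫ x, divergence Z x = 0 := by
  have hZi : ∀ i, ContDiff ℝ ∞ fun x => Z x i := contDiff_euclidean.1 hZ
  have hci : ∀ i, HasCompactSupport fun x => Z x i := fun i =>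
    hc.comp_left (g := fun v : Space n => v i) rfl
  have h : ∀ x, divergence Z x =
      ∑ i, fderiv ℝ (fun y => Z y i) x (EuclideanSpace.single i 1) := by
    intro x
    refine Finset.sum_congr rfl fun i _ => ?_
    rw [fderiv_component (hZ.differentiable (by simp) x)]
    rfl
  simp only [h]
  rw [integral_finsetSum]
  · exact Finset.sum_eq_zero fun i _ => integral_fderiv_apply_eq_zero (hZi i) (hci i) _
  · intro i _
    exact (((contDiff_fderiv (hZi i)).clm_apply
      contDiff_const).continuous).integrable_of_hasCompactSupport
        ((hci i).fderiv_apply (𝕜 := ℝ) (v := EuclideanSpace.single i 1))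

/-- Off `K` the two fields agree near each point, hence so do their jets and the values of `Θ`. The
difference is thus the divergence of a compactly supported field. -/
theorem IsSpatialDivergence.integral_sub_eq_zero {n : ℕ} {F : Type*} [NormedAddCommGroup F]
    [NormedSpace ℝ F] {Ω : Set F} {L : ℝ → (Space n → F) → Space n → ℝ}
    (hL : IsSpatialDivergence Ω L) (t : ℝ) {q q' : Space n → F} (hq : IsSmoothField Ω q)
    (hq' : IsSmoothField Ω q') {K : Set (Space n)} (hK : IsCompact K)
    (hqq' : ∀ x ∉ K, q x = q' x) : ∫ x, (L t q x - L t q' x) = 0 := by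
  obtain ⟨k, Θ, hΘ, h⟩ := hL
  have hX : ∀ q, IsSmoothField Ω q →
      ContDiff ℝ ∞ fun y => Θ (t, y, q y, fun j : Fin k => iteratedFDeriv ℝ (j + 1) q y) := by
    intro q hq
    refine hΘ.comp_contDiff (contDiff_const.prodMk (contDiff_id.prodMk (hq.1.prodMk ?_))) hq.2
    exact contDiff_pi.2 fun j => hq.1.iteratedFDeriv_right
      (WithTop.coe_le_coe.2 (le_top : (⊤ + ((j + 1 : ℕ) : ℕ∞) : ℕ∞) ≤ ⊤))
  have hd := fun q hq x => (hX q hq).differentiable (by simp) x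
  have hdiv : ∀ x, L t q x - L t q' x = divergence (fun y =>
      Θ (t, y, q y, fun j : Fin k => iteratedFDeriv ℝ (j + 1) q y) -
      Θ (t, y, q' y, fun j : Fin k => iteratedFDeriv ℝ (j + 1) q' y)) x := by
    intro x
    rw [h t q hq, h t q' hq']
    simp only [divergence, partialDeriv]
    rw [← Finset.sum_sub_distrib]
    refine Finset.sum_congr rfl fun i _ => ?_
    rw [((hd q hq x).hasFDerivAt.fun_sub (hd q' hq' x).hasFDerivAt).fderiv]
    rfl
  simp only [hdiv]
  refine integral_divergence_eq_zero ((hX q hq).sub (hX q' hq')) (HasCompactSupport.intro hK ?_)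
  intro x hx
  have hev : q =ᶠ[nhds x] q' :=
    Filter.eventually_of_mem (hK.isClosed.isOpen_compl.mem_nhds hx) hqq'
  have hjet : ∀ j : Fin k, iteratedFDeriv ℝ (j + 1) q x = iteratedFDeriv ℝ (j + 1) q' x :=
    fun j => (hev.iteratedFDeriv ℝ (j + 1)).eq_of_nhds
  simp only [hjet, hqq' x hx, sub_self]

/-- The matrix is the congruence of the block matrix by the identity with column 1 replaced by `a`,
whose determinant is the entry `a 1`. It yields test fields whose vorticity is a single partial
derivative. -/
theorem scalarForm_firstRow {m : ℕ} (hm : 1 ≤ m) (a : Fin (2 * m) → ℝ) :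
    scalarForm m (fun i j => if i.1 = 0 then a j else
      pairMatrix (evenLeft m) (evenRight m) i j) =
      a ⟨1, by omega⟩ * scalarForm m (pairMatrix (evenLeft m) (evenRight m)) := by
  have h := scalarForm_conj m (pairMatrix (evenLeft m) (evenRight m))
    ((1 : Matrix (Fin (2 * m)) (Fin (2 * m)) ℝ).updateCol ⟨1, by omega⟩ a)
  have hdet : ((1 : Matrix (Fin (2 * m)) (Fin (2 * m)) ℝ).updateCol ⟨1, by omega⟩ a).det =
      a ⟨1, by omega⟩ := by
    rw [← Matrix.cramer_apply, Matrix.cramer_one]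
    rfl
  rw [hdet] at h
  rw [← h]
  congr 1
  funext i j
  have hJ : ∀ b c : Fin (2 * m), pairMatrix (evenLeft m) (evenRight m) b c ≠ 0 →
      b.1 ≠ 1 ∧ c.1 = b.1 + 1 := by
    intro b c hbc
    by_cases hk : ∃ k, b = evenLeft m k ∧ c = evenRight m k
    · obtain ⟨k, rfl, rfl⟩ := hk
      rw [evenLeft_val, evenRight_val]
      omega
    · exact (hbc (if_neg hk)).elim
  have hJ0 : pairMatrix (evenLeft m) (evenRight m) ⟨0, by omega⟩ ⟨1, by omega⟩ = 1 :=
    if_pos ⟨⟨0, by omega⟩, rfl, rfl⟩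
  have hterm : ∀ b c, (1 : Matrix (Fin (2 * m)) (Fin (2 * m)) ℝ).updateCol ⟨1, by omega⟩ a i b *
      pairMatrix (evenLeft m) (evenRight m) b c *
      (1 : Matrix (Fin (2 * m)) (Fin (2 * m)) ℝ).updateCol ⟨1, by omega⟩ a j c =
      if i = b then (if i.1 = 0 then (if c = ⟨1, by omega⟩ then a j else 0) else
        (if j = c then pairMatrix (evenLeft m) (evenRight m) i j else 0)) else 0 := by
    intro b c
    by_cases hbc : pairMatrix (evenLeft m) (evenRight m) b c = 0
    · rw [hbc, mul_zero, zero_mul]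
      split_ifs with h1 h2 h3 h4
      · exfalso
        have : b = ⟨0, by omega⟩ := Fin.ext (by rw [← h1, h2])
        rw [this, h3, hJ0] at hbc
        exact one_ne_zero hbc
      · rfl
      · rw [h1, h4, hbc]
      · rfl
      · rfl
    · obtain ⟨hb, hc⟩ := hJ b c hbc
      have hb1 : b ≠ ⟨1, by omega⟩ := fun h => hb (congrArg Fin.val h)
      rw [Matrix.updateCol_ne hb1, Matrix.one_apply]
      split_ifs with h1 h2 h3 h4
      · rw [h3, Matrix.updateCol_self]
        have : b = ⟨0, by omega⟩ := Fin.ext (by rw [← h1, h2])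
        rw [this, hJ0]
        ring
      · exfalso
        exact h3 (Fin.ext (by rw [hc, ← h1, h2]))
      · have hc1 : c ≠ ⟨1, by omega⟩ := fun h => by
          have := congrArg Fin.val h
          rw [hc, ← h1] at this
          simp at this
          exact h2 (by simp [this])
        rw [Matrix.updateCol_ne hc1, Matrix.one_apply, if_pos h4, h1, h4]
        ring
      · have hc1 : c ≠ ⟨1, by omega⟩ := fun h => by
          have := congrArg Fin.val h
          rw [hc, ← h1] at this
          simp at this
          exact h2 (by simp [this])
        rw [Matrix.updateCol_ne hc1, Matrix.one_apply, if_neg h4, mul_zero]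
      · simp
  simp only [hterm, Finset.sum_ite_irrel, Finset.sum_const_zero, Finset.sum_ite_eq,
    Finset.sum_ite_eq', Finset.mem_univ, if_true]

/-- With ρ = 1 and a velocity whose component 0 is a free function `h`, the other components being a
fixed linear field, the vorticity is κ ∂₁h. Compactly supported changes of `h` preserve the integral
of f(κ ∂₁h) - g(x, h), so the one-dimensional null Lagrangian argument applies. -/
theorem IsEnstrophyDensity.isAffine {m : ℕ} (hm : 1 ≤ m) {f : ℝ → ℝ} (hf : ContDiff ℝ ∞ f)
    {T : Space (2 * m) × ℝ → ℝ → ℝ} (hT : IsEnstrophyDensity f T)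
    (hkin : IsKinematicUpToDivergence (isentropicPhysical (2 * m)) (vorticityScalar m) T) :
    IsAffine f := by
  obtain ⟨K, hK, hdiv⟩ := hkin
  set κ := scalarForm m (pairMatrix (evenLeft m) (evenRight m))
  have hκ : 0 < κ := scalarForm_pairMatrix_pos m
  -- `B` is the block matrix with row 0 cleared; the gradient of `h` fills that row.
  set B : Fin (2 * m) → Fin (2 * m) → ℝ := fun i j =>
    if i.1 = 0 then 0 else pairMatrix (evenLeft m) (evenRight m) i j with hB
  set e₀ : Space (2 * m) := EuclideanSpace.single ⟨0, by omega⟩ 1 with he₀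
  set e₁ : Space (2 * m) := EuclideanSpace.single ⟨1, by omega⟩ 1 with he₁
  let q : (Space (2 * m) → ℝ) → Space (2 * m) → Space (2 * m) × ℝ := fun h y =>
    (linearField B y + h y • e₀, 1)
  have hq : ∀ h, ContDiff ℝ ∞ h → IsSmoothField (isentropicPhysical (2 * m)) (q h) := fun h hh =>
    ⟨((linearField B).contDiff.add (hh.smul contDiff_const)).prodMk contDiff_const,
      fun _ => show (0 : ℝ) < 1 from one_pos⟩
  have hdens : ∀ h, ContDiff ℝ ∞ h → ∀ x, densityAt (vorticityScalar m) T (q h) x =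
      f (fderiv ℝ h x e₁ * κ) := by
    intro h hh x
    have hgrad : velocityGradient (fun y => (q h y).1) x = fun i j => if i.1 = 0 then
        fderiv ℝ h x (EuclideanSpace.single j 1) else
          pairMatrix (evenLeft m) (evenRight m) i j := by
      funext i j
      have hd := (linearField B).hasFDerivAt.fun_add
        ((hh.differentiable (by simp) x).hasFDerivAt.smul_const e₀)
      rw [velocityGradient, partialDeriv, hd.fderiv]
      by_cases hi : i.1 = 0
      · have hi' : i = ⟨0, by omega⟩ := Fin.ext hi
        simp [hB, he₀, hi']
      · have hi' : i ≠ ⟨0, by omega⟩ := fun h => hi (congrArg Fin.val h)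
        simp [hB, he₀, hi, hi']
    rw [densityAt, vorticityScalar_eq, curl_eq_skewPart, scalarForm_skewPart, hgrad,
      scalarForm_firstRow hm]
    refine (hT _ 1 _ one_pos).trans ?_
    rw [one_mul, div_one]
  have hfκ : ContDiff ℝ ∞ fun s => f (s * κ) := hf.comp (contDiff_id.mul contDiff_const)
  -- On the test fields, at time 0, the kinematic density depends on the point and the value of `h`
  -- only.
  have hg : ContDiff ℝ ∞ fun p : Space (2 * m) × ℝ =>
      K (0, p.1, (linearField B p.1 + p.2 • e₀, 1)) :=
    hK.comp_contDiff (contDiff_const.prodMk (contDiff_fst.prodMk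
      ((((linearField B).contDiff.comp contDiff_fst).add
        (contDiff_snd.smul contDiff_const)).prodMk contDiff_const))) fun _ => show (0 : ℝ) < 1 from one_pos
  have hl : (EuclideanSpace.proj (⟨1, by omega⟩ : Fin (2 * m)) : Space (2 * m) →L[ℝ] ℝ) e₁ = 1 := by
    simp [he₁]
  have h2 := deriv_deriv_eq_zero_of_null (μ := volume) hl hfκ hg fun h φ hh hφ hc => ?_
  · obtain ⟨a, b, hab⟩ := isAffine_of_deriv_deriv_eq_zero hfκ h2
    refine ⟨a / κ, b, fun s => ?_⟩
    have : f (s / κ * κ) = a * (s / κ) + b := hab (s / κ)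
    rw [div_mul_cancel₀ _ hκ.ne'] at this
    rw [this]
    ring
  · have h0 := hdiv.integral_sub_eq_zero 0 (hq (fun y => h y + φ y) (hh.add hφ)) (hq h hh) hc
      fun x hx => by simp [q, image_eq_zero_of_notMem_tsupport hx]
    simp only [hdens _ (hh.add hφ), hdens h hh] at h0
    exact h0

end CompressibleFlow

theorem proposition2 :
    -- non-isentropic equations of state, in even and in odd dimensions
    (∀ P : ℝ → ℝ → ℝ, IsNonIsentropicEOS P → ∀ m : ℕ, 1 ≤ m →
      ((¬ ∃ T : Space (2 * m) × ℝ × ℝ → ℝ → ℝ,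
          IsVorticityConstantOfMotion (physical (2 * m)) (eulerRate P) (vorticityScalar m) T) ∧
        (∀ T : Space (2 * m) × ℝ × ℝ → ℝ → ℝ,
          IsConservedOnMovingDomains (physical (2 * m)) (eulerRate P) (vorticityScalar m) T →
          IsVorticityIndependent (physical (2 * m)) T)) ∧
      ((¬ ∃ T : Space (2 * m + 1) × ℝ × ℝ → Space (2 * m + 1) → ℝ,
          IsVorticityConstantOfMotion (physical (2 * m + 1)) (eulerRate P)
            (vorticityVector m) T) ∧
        (∀ T : Space (2 * m + 1) × ℝ × ℝ → Space (2 * m + 1) → ℝ,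
          IsConservedOnMovingDomains (physical (2 * m + 1)) (eulerRate P) (vorticityVector m) T →
          IsVorticityIndependent (physical (2 * m + 1)) T))) ∧
    -- isentropic equations of state, in even and in odd dimensions
    (∀ P : ℝ → ℝ, IsIsentropicEOS P → ∀ m : ℕ, 1 ≤ m →
      (∀ T : Space (2 * m) × ℝ → ℝ → ℝ,
        (IsVorticityConstantOfMotion (isentropicPhysical (2 * m)) (isentropicRate P)
            (vorticityScalar m) T ↔
          ∃ f : ℝ → ℝ, ContDiff ℝ ∞ f ∧ ¬ IsAffine f ∧ IsEnstrophyDensity f T) ∧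
        (IsConservedOnMovingDomains (isentropicPhysical (2 * m)) (isentropicRate P)
            (vorticityScalar m) T ↔
          ∃ f : ℝ → ℝ, ContDiff ℝ ∞ f ∧ IsEnstrophyDensity f T)) ∧
      ((¬ ∃ T : Space (2 * m + 1) × ℝ → Space (2 * m + 1) → ℝ,
          IsVorticityConstantOfMotion (isentropicPhysical (2 * m + 1)) (isentropicRate P)
            (vorticityVector m) T) ∧
        (∀ T : Space (2 * m + 1) × ℝ → Space (2 * m + 1) → ℝ,
          IsConservedOnMovingDomains (isentropicPhysical (2 * m + 1)) (isentropicRate P)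
            (vorticityVector m) T →
          IsVorticityIndependent (isentropicPhysical (2 * m + 1)) T))) := by
  refine ⟨fun P hP m hm => ⟨⟨?_, fun T hT => isVorticityIndependent_euler_even hP hm hT⟩,
    ⟨?_, fun T hT => isVorticityIndependent_euler_odd hP hm hT⟩⟩,
    fun P hP m hm => ⟨fun T => ⟨⟨?_, ?_⟩, ⟨fun hT => exists_isEnstrophyDensity hP hm hT, ?_⟩⟩,
      ⟨?_, fun T hT => isVorticityIndependent_isentropic_odd hP hm hT⟩⟩⟩
  -- A conserved density that is independent of the vorticity is kinematic, contrary to the second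
  -- clause of a vorticity constant of motion.
  · rintro ⟨T, hT, hT'⟩
    exact hT' ((isVorticityIndependent_euler_even hP hm hT).isKinematicUpToDivergence hT.1)
  · rintro ⟨T, hT, hT'⟩
    exact hT' ((isVorticityIndependent_euler_odd hP hm hT).isKinematicUpToDivergence hT.1)
  · rintro ⟨hT, hT'⟩
    obtain ⟨f, hf, hfT⟩ := exists_isEnstrophyDensity hP hm hT
    exact ⟨f, hf, fun ha => hT' (hfT.isKinematicUpToDivergence_of_isAffine hm ha), hfT⟩
  · rintro ⟨f, hf, hna, hfT⟩
    exact ⟨hfT.isConservedOnMovingDomains hP hf, fun hk => hna (hfT.isAffine hm hf hk)⟩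
  · rintro ⟨f, hf, hfT⟩
    exact hfT.isConservedOnMovingDomains hP hf
  · rintro ⟨T, hT, hT'⟩
    exact hT' ((isVorticityIndependent_isentropic_odd hP hm hT).isKinematicUpToDivergence hT.1)
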